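/- **Theorem (Explicit Iwasawa decomposition).** Let $a,b\in\mathbb C$ with $ab\neq 0$ and let $$D(\lambda)=\begin{pmatrix}0&-\lambda\bar b&\lambda^{-1}a\\ \lambda^{-1}b&0&-\lambda\bar a\\ -\lambda\bar a&\lambda^{-1}a&0\end{pmatrix},\qquad L_0=D^2-\tfrac13\mathrm{tr}(D^2)I,\qquad \psi=-ia^2b .$$ *Data.* Put $a_1=|a|^2$, $\beta=2a_1+|\psi|^2/a_1^2$, $h=\frac\beta2-a_1$, $a_2=\frac12\big(h+\sqrt{h^2+4a_1h}\big)$, $a_3=\frac12\big(-h+\sqrt{h^2+4a_1h}\big)$, $k^2=\frac{a_1-a_2}{a_1+a_3}$, $q^2=\frac{a_1-a_2}{a_1}$, $r=\sqrt{2(a_1+a_3)}$, and let $u$ be given by $$e^{u(y)}=a_1\big(1-q^2\,\mathrm{sn}^2(ry,k)\big).$$ Only $k^2<1$ and $q^2$ enter: $\mathrm{sn}(x,k)=\sin\theta$ where $x=\int_0^\theta(1-k^2\sin^2\alpha)^{-1/2}d\alpha$; for $|a|>|b|$ one has $0<k^2<1$, for $|a|=|b|$ one has $k^2=0$ and $u$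 is constant, and for $|a|<|b|$ one has $k^2<0$. Put $$Q_0=\mathrm{diag}(ia^{-1}e^{u/2},-iae^{-u/2},1),\qquad \tilde Q=\frac{\lambda^3}{\kappa}\begin{pmatrix}\check p&\check q&\check v_1\\ \check s&\check t&\check v_2\\0&0&\check c\end{pmatrix},\qquad Q=Q_0\tilde Q,$$ $$\check p=-|a|^2\tfrac{u'}2+\lambda^3\bar\psi|a|^2e^{-u}-\lambda^{-3}\psi,\qquad \check q=\tfrac{\lambda^{-2}a}{\bar a}\big[\tfrac{u'}2|a|^2-\lambda^3\bar\psi e^{-u}(|a|^2-e^u)\big],$$ $$\check s=\tfrac{\lambda^2}{a^2}\big[|a|^2\tfrac{u'}2e^u+\lambda^{-3}\psi(|a|^2-e^u)\big],\qquad \check t=\tfrac1{|a|^2}\big(-|a|^2\tfrac{u'}2e^u+\lambda^3\bar\psi e^u-\lambda^{-3}\psi|a|^2\big),$$ $$\check v_1=-2i\lambda^{-1}a(|a|^2-e^u),\quad \check v_2=-2i\lambda a^{-1}e^u(|a|^2-e^u),\quad \check c=\lambda^3\bar\psi-\lambda^{-3}\psi-e^uu',$$ $$\kappa=(\lambda^6\bar\psi-\psi-\lambda^3e^uu')^{2/3}(\lambda^6\bar\psi-\psi)^{1/3},$$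 where the branch of the cube root is the one that is continuous on the segment from $0$ to $y$ and has the value $\kappa=\lambda^6\bar\psi-\psi$ at $y=0$, and $$\beta_1(y,\lambda)=\int_0^y\frac{2i\lambda^3\bar\psi-iu'e^u}{\lambda^3\bar\psi-\lambda^{-3}\psi-e^uu'}ds,\qquad \beta_2(y,\lambda)=\int_0^y\frac{2e^u}{\lambda^3\bar\psi-\lambda^{-3}\psi-e^uu'}ds .$$ *Terminology.* Let $\epsilon=e^{\pi i/3}$ and $\sigma(g)=P(g^t)^{-1}P^{-1}$ with $P=\begin{pmatrix}0&\alpha&0\\ \alpha^2&0&0\\0&0&1\end{pmatrix}$, $\alpha=e^{2\pi i/3}$. A loop $g$ is twisted if $\sigma(g(\lambda))=g(\epsilon\lambda)$. The *extended frame generated by $D\,dz$* is the map $z\mapsto F(z,\cdot)$ into the twisted continuous loops $S^1\to SU(3)$ for which, for every $z\in\mathbb C$, $\exp(zD(\lambda))=F(z,\lambda)V_+(z,\lambda)$ on $S^1$, where $V_+(z,\cdot)$ is a twisted $SL(3,\mathbb C)$-valued loop, continuous on the closed unit disc and holomorphic inside, with positive diagonal entries at $\lambda=0$. *Claim.* The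 right hand side defining $e^{u}$ is positive, and $u$ is a differentiable function on $\mathbb R$. There is a map $\mathbb F:\mathbb C\times\mathbb C^*\to SL(3,\mathbb C)$, holomorphic in $\lambda$, with values in the twisted loops in $SU(3)$ for $|\lambda|=1$, such that, with $z=x+iy$ and $u=u(y)$: 1. $\mathbb F$ satisfies the frame equations of a minimal Lagrangian surface in $\mathbb CP^2$ with metric $2e^u\,dz\,d\bar z$ and cubic form given by $\psi\,dz^3$, $$\mathbb F^{-1}\mathbb F_z=\begin{pmatrix}\frac{u_z}2&0&i\lambda^{-1}e^{u/2}\\-i\lambda^{-1}\psi e^{-u}&-\frac{u_z}2&0\\0&i\lambda^{-1}e^{u/2}&0\end{pmatrix},\qquad \mathbb F^{-1}\mathbb F_{\bar z}=\begin{pmatrix}-\frac{u_{\bar z}}2&-i\lambda\bar\psi e^{-u}&0\\0&\frac{u_{\bar z}}2&i\lambda e^{u/2}\\ i\lambda e^{u/2}&0&0\end{pmatrix},$$ and is translationally equivariant: $\mathbb F(t+z,\lambda)=e^{tD(\lambda)}\mathbb F(z,\lambda)$ for $t\in\mathbb R$. 2. $\mathbb F(0,\lambda)=Q_0(0)^{-1}$,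 where $Q_0(0)=\mathrm{diag}(i|a|/a,\,-ia/|a|,\,1)$, and $\mathbb F(z,\lambda)Q_0(0)$ is the unique extended frame generated by $D\,dz$. In particular, if $a=i|a|$ (that is, $a=ie^{u(0)/2}$), then $Q_0(0)=I$ and $\mathbb F$ itself is the extended frame generated by $D\,dz$. 3. For all $z\in\mathbb C$ and $\lambda\in\mathbb C^*$ such that $\check c(s,\lambda)\neq0$ for all $s$ between $0$ and $y$, the branch $\kappa$ exists, $\det Q=1$, and $$\mathbb F(z,\lambda)=\exp\big(zD-\beta_1(y,\lambda)D-\beta_2(y,\lambda)L_0\big)\,Q^{-1}(y,\lambda).$$ 4. The condition in 3 holds for all $z$ if $|\lambda|=1$ and $\lambda^6\bar\psi\neq\psi$ (all but six points of the circle), and also for all $z$ and all sufficiently small $\lambda\neq0$. -/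

import Mathlib

noncomputable section

/-- Complex `3 × 3` matrices. -/
abbrev Mat3 : Type := Matrix (Fin 3) (Fin 3) ℂ

namespace MinLag

open Complex ComplexConjugate

/-! ### Twisted loops in `SL(3, ℂ)` and Iwasawa splittings -/

/-- The matrix `P` in the definition of the order six automorphism `σ`, with `α = exp (2πi/3)`. -/
def twistP : Mat3 :=
  !![0, exp (2 * Real.pi * I / 3), 0;
     exp (2 * Real.pi * I / 3) ^ 2, 0, 0;
     0, 0, 1]

/-- The automorphism `σ(g) = P (gᵗ)⁻¹ P⁻¹` of `SL(3, ℂ)`. -/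
def sigma (g : Mat3) : Mat3 := twistP * (g.transpose)⁻¹ * twistP⁻¹

/-- The primitive sixth root of unity `ε = exp (πi/3)`. -/
def eps : ℂ := exp (Real.pi * I / 3)

/-- `h ∈ Λ SU(3)_σ`: a continuous loop `S¹ → SU(3)` with `σ(h(λ)) = h(ελ)`.
Only the values of `h` on the unit circle matter. -/
structure IsUnitaryLoop (h : ℂ → Mat3) : Prop where
  continuousOn : ∀ i j, ContinuousOn (fun l => h l i j) (Metric.sphere 0 1)
  mem : ∀ l ∈ Metric.sphere (0 : ℂ) 1, h l ∈ Matrix.specialUnitaryGroup (Fin 3) ℂ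
  twisted : ∀ l ∈ Metric.sphere (0 : ℂ) 1, sigma (h l) = h (eps * l)

/-- `v ∈ Λ⁺ SL(3, ℂ)_σ`: a twisted loop in `SL(3, ℂ)` that extends continuously to the closed
unit disc, holomorphically in its interior. -/
structure IsPlusLoop (v : ℂ → Mat3) : Prop where
  holomorphic : ∀ i j, DiffContOnCl ℂ (fun l => v l i j) (Metric.ball 0 1)
  det_eq : ∀ l ∈ Metric.closedBall (0 : ℂ) 1, (v l).det = 1
  twisted : ∀ l ∈ Metric.closedBall (0 : ℂ) 1, sigma (v l) = v (eps * l)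

/-- `g = h v` is the Iwasawa splitting of the loop `g`, normalized so that the diagonal entries
of `v` at `λ = 0` are positive. -/
structure IsIwasawaSplitting (g h v : ℂ → Mat3) : Prop where
  unitary : IsUnitaryLoop h
  plus : IsPlusLoop v
  pos_diag : ∀ i, (v 0 i i).im = 0 ∧ 0 < (v 0 i i).re
  eq_mul : ∀ l ∈ Metric.sphere (0 : ℂ) 1, g l = h l * v l

/-- `F(z, λ)` is the (normalized) extended frame generated by the constant potential `D(λ) dz`:
for every `z`, `F(z, ·)` is the unitary factor of the normalized Iwasawa splitting of
`C(z, λ) = exp (z D(λ))`, the solution of `dC = C D dz`, `C(0, λ) = I`. -/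
def IsGeneratedBy (D : ℂ → Mat3) (F : ℂ → ℂ → Mat3) : Prop :=
  ∀ z, ∃ v, IsIwasawaSplitting (fun l => NormedSpace.exp (z • D l)) (F z) v

/-! ### The frame equations of a minimal Lagrangian surface -/

/-- The Wirtinger derivative `∂f/∂z`. -/
def dz (f : ℂ → ℂ) (z : ℂ) : ℂ := (fderiv ℝ f z 1 - I * fderiv ℝ f z I) / 2

/-- The Wirtinger derivative `∂f/∂z̄`. -/
def dzbar (f : ℂ → ℂ) (z : ℂ) : ℂ := (fderiv ℝ f z 1 + I * fderiv ℝ f z I) / 2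

/-- `λ⁻¹ U₋₁ + U₀`. -/
def frameU (u : ℂ → ℝ) (psi : ℂ) (z l : ℂ) : Mat3 :=
  l⁻¹ • !![0, 0, I * Real.exp (u z / 2);
           -I * psi * Real.exp (-u z), 0, 0;
           0, I * Real.exp (u z / 2), 0]
  + !![dz (fun w => (u w : ℂ)) z / 2, 0, 0;
       0, -dz (fun w => (u w : ℂ)) z / 2, 0;
       0, 0, 0]

/-- `λ V₁ + V₀`. -/
def frameV (u : ℂ → ℝ) (psi : ℂ) (z l : ℂ) : Mat3 :=
  l • !![0, -I * conj psi * Real.exp (-u z), 0;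
         0, 0, I * Real.exp (u z / 2);
         I * Real.exp (u z / 2), 0, 0]
  + !![-dzbar (fun w => (u w : ℂ)) z / 2, 0, 0;
       0, dzbar (fun w => (u w : ℂ)) z / 2, 0;
       0, 0, 0]

/-- `F : ℂ × ℂ* → SL(3, ℂ)` is an extended frame of the minimal Lagrangian surface with metric
`2 eᵘ dz dz̄` and (constant) Hopf differential `ψ dz³`: it is holomorphic in `λ ∈ ℂ*`, lies in
`Λ SU(3)_σ`, and satisfies `F⁻¹ F_z = λ⁻¹ U₋₁ + U₀`, `F⁻¹ F_z̄ = λ V₁ + V₀`. -/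
structure IsExtendedFrame (u : ℂ → ℝ) (psi : ℂ) (F : ℂ → ℂ → Mat3) : Prop where
  holomorphic : ∀ z i j, DifferentiableOn ℂ (fun l => F z l i j) {0}ᶜ
  unitary : ∀ z, IsUnitaryLoop (F z)
  det_eq : ∀ z l, l ≠ 0 → (F z l).det = 1
  differentiable : ∀ l, l ≠ 0 → ∀ i j, Differentiable ℝ (fun z => F z l i j)
  eq_dz : ∀ l, l ≠ 0 → ∀ z,
    (F z l)⁻¹ * Matrix.of (fun i j => dz (fun w => F w l i j) z) = frameU u psi z l
  eq_dzbar : ∀ l, l ≠ 0 → ∀ z,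
    (F z l)⁻¹ * Matrix.of (fun i j => dzbar (fun w => F w l i j) z) = frameV u psi z l

/-! ### The Jacobi elliptic function `sn` -/

/-- The elliptic integral of the first kind `J(θ, k) = ∫₀^θ dα / √(1 - k² sin² α)`, as a
function of `m = k²`. -/
def ellipticJ (m θ : ℝ) : ℝ := ∫ α in (0 : ℝ)..θ, 1 / Real.sqrt (1 - m * Real.sin α ^ 2)

/-- The Jacobi elliptic function `sn(x, k)`, as a function of `m = k² < 1`: the sine of the
amplitude `θ`, where `x = J(θ, k)`. -/
def jacobiSn (m x : ℝ) : ℝ := Real.sin (Function.invFun (ellipticJ m) x)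

/-! ### The potential and the data attached to it -/

/-- The potential matrix `D(λ)` with vanishing diagonal. -/
def potential (a b l : ℂ) : Mat3 :=
  !![0, -l * conj b, l⁻¹ * a;
     l⁻¹ * b, 0, -l * conj a;
     -l * conj a, l⁻¹ * a, 0]

/-- `L₀ = D² - (1/3) tr(D²) I`. -/
def L0 (a b l : ℂ) : Mat3 :=
  potential a b l ^ 2 - ((1 / 3 : ℂ) * (potential a b l ^ 2).trace) • (1 : Mat3)

/-- The coefficient `ψ = -i a² b` of the Hopf differential. -/
def psi (a b : ℂ) : ℂ := -I * a ^ 2 * b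

/-- `a₁ = |a|²`, which is `e^{u(0)}`. -/
def a1 (a : ℂ) : ℝ := ‖a‖ ^ 2

/-- `β = 2 a₁ + |ψ|² / a₁²`. -/
def betaConst (a b : ℂ) : ℝ := 2 * a1 a + ‖psi a b‖ ^ 2 / a1 a ^ 2

def a2 (a b : ℂ) : ℝ :=
  ((betaConst a b / 2 - a1 a)
    + Real.sqrt ((betaConst a b / 2 - a1 a) ^ 2 + 4 * a1 a * (betaConst a b / 2 - a1 a))) / 2

def a3 (a b : ℂ) : ℝ :=
  (-(betaConst a b / 2 - a1 a)
    + Real.sqrt ((betaConst a b / 2 - a1 a) ^ 2 + 4 * a1 a * (betaConst a b / 2 - a1 a))) / 2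

/-- `k² = (a₁ - a₂) / (a₁ + a₃)`. -/
def kSq (a b : ℂ) : ℝ := (a1 a - a2 a b) / (a1 a + a3 a b)

/-- `q² = (a₁ - a₂) / a₁`. -/
def qSq (a b : ℂ) : ℝ := (a1 a - a2 a b) / a1 a

/-- `r = √(2 (a₁ + a₃))`. -/
def rConst (a b : ℂ) : ℝ := Real.sqrt (2 * (a1 a + a3 a b))

/-- The conformal factor `w(y) = a₁ (1 - q² sn²(r y, k))`. -/
def conformalFactor (a b : ℂ) (y : ℝ) : ℝ :=
  a1 a * (1 - qSq a b * jacobiSn (kSq a b) (rConst a b * y) ^ 2)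

/-- The function `u(y)` with `e^u = a₁ (1 - q² sn²(r y, k))`. -/
def u (a b : ℂ) (y : ℝ) : ℝ := Real.log (conformalFactor a b y)

/-- `e^{u(y)}`, as a complex number. -/
def eu (a b : ℂ) (y : ℝ) : ℂ := (Real.exp (u a b y) : ℂ)

/-- `u'(y)`, as a complex number. -/
def du (a b : ℂ) (y : ℝ) : ℂ := ((deriv (u a b) y : ℝ) : ℂ)

/-- `|a|²`, as a complex number. -/
def aSq (a : ℂ) : ℂ := ((‖a‖ ^ 2 : ℝ) : ℂ)

/-- `Q₀ = diag(i a⁻¹ e^{u/2}, -i a e^{-u/2}, 1)`. -/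
def Q0 (a b : ℂ) (y : ℝ) : Mat3 :=
  !![I * a⁻¹ * Real.exp (u a b y / 2), 0, 0;
     0, -I * a * Real.exp (-u a b y / 2), 0;
     0, 0, 1]

def pCheck (a b : ℂ) (y : ℝ) (l : ℂ) : ℂ :=
  -aSq a * (du a b y / 2) + l ^ 3 * conj (psi a b) * aSq a * (eu a b y)⁻¹ - (l ^ 3)⁻¹ * psi a b

def qCheck (a b : ℂ) (y : ℝ) (l : ℂ) : ℂ :=
  (l ^ 2)⁻¹ * a / conj a *
    (du a b y / 2 * aSq a - l ^ 3 * conj (psi a b) * (eu a b y)⁻¹ * (aSq a - eu a b y))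

def sCheck (a b : ℂ) (y : ℝ) (l : ℂ) : ℂ :=
  l ^ 2 / a ^ 2 *
    (aSq a * (du a b y / 2) * eu a b y + (l ^ 3)⁻¹ * psi a b * (aSq a - eu a b y))

def tCheck (a b : ℂ) (y : ℝ) (l : ℂ) : ℂ :=
  1 / aSq a *
    (-aSq a * (du a b y / 2) * eu a b y + l ^ 3 * conj (psi a b) * eu a b y
      - (l ^ 3)⁻¹ * psi a b * aSq a)

def v1Check (a b : ℂ) (y : ℝ) (l : ℂ) : ℂ := -2 * I * l⁻¹ * a * (aSq a - eu a b y)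

def v2Check (a b : ℂ) (y : ℝ) (l : ℂ) : ℂ := -2 * I * l * a⁻¹ * eu a b y * (aSq a - eu a b y)

def cCheck (a b : ℂ) (y : ℝ) (l : ℂ) : ℂ :=
  l ^ 3 * conj (psi a b) - (l ^ 3)⁻¹ * psi a b - eu a b y * du a b y

/-- `κ = (λ⁶ψ̄ - ψ - λ³ eᵘ u')^{2/3} (λ⁶ψ̄ - ψ)^{1/3}` between `0` and `y`: the branch of the cube
root is the one that is continuous in `s` and gives `κ = λ⁶ψ̄ - ψ` at `s = 0`. -/
structure IsKappa (a b l : ℂ) (y : ℝ) (κ : ℝ → ℂ) : Prop where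
  continuousOn : ContinuousOn κ (Set.uIcc 0 y)
  cube : ∀ s ∈ Set.uIcc 0 y, κ s ^ 3 =
    (l ^ 6 * conj (psi a b) - psi a b - l ^ 3 * eu a b s * du a b s) ^ 2
      * (l ^ 6 * conj (psi a b) - psi a b)
  zero : κ 0 = l ^ 6 * conj (psi a b) - psi a b

/-- `Q̃(y, λ)`, where `k` stands for the value `κ(y, λ)`. -/
def Qtilde (a b : ℂ) (y : ℝ) (l k : ℂ) : Mat3 :=
  (l ^ 3 / k) • !![pCheck a b y l, qCheck a b y l, v1Check a b y l;
                   sCheck a b y l, tCheck a b y l, v2Check a b y l;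
                   0, 0, cCheck a b y l]

/-- `Q = Q₀ Q̃`. -/
def Q (a b : ℂ) (y : ℝ) (l k : ℂ) : Mat3 := Q0 a b y * Qtilde a b y l k

def beta1 (a b : ℂ) (y : ℝ) (l : ℂ) : ℂ :=
  ∫ s in (0 : ℝ)..y,
    (2 * I * l ^ 3 * conj (psi a b) - I * du a b s * eu a b s) / cCheck a b s l

def beta2 (a b : ℂ) (y : ℝ) (l : ℂ) : ℂ :=
  ∫ s in (0 : ℝ)..y, 2 * eu a b s / cCheck a b s l

end MinLag

end

/-! Since u depends on y alone, everything reduces to linear differential equations in y. Write w =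
eᵘ. The constants are chosen so that w'² = -8 (w - a₁)(w - a₂)(w + a₃) (`conformalDeriv_sq`). With
the matching second-order equation this gives u'' = 4(|ψ|² e⁻²ᵘ - eᵘ) (`hasDerivAt_deriv_u`), the
integrability condition of the frame equations.

Let X = U + V and Y = i(U - V) be the coefficient matrices in the directions x and y. Integrability
is the Lax equation X' = [X, Y]. If S' = SY and S(0) = Q₀(0)⁻¹, then S X S⁻¹ is constant, and the
initial value makes it equal to D (`potential_mul_frameSol`). Hence 𝔽 = exp(xD) S(y) solves both
frame equations and is equivariant. Determinant, unitarity and twisting follow from the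
infinitesimal symmetries of Y and D, because suitable products of solutions are constant
(`IsSol.mul_eq`). Holomorphy in λ comes from the Picard series (`differentiableOn_sol`).

Iwasawa splitting: Y - iX contains no λ⁻¹, and exp(-iyD) S solves the linear equation with this
coefficient (`exp_mul_frameSol`). It is therefore entire in λ, and solving for exp(zD) exhibits the
splitting. For uniqueness, the quotient of two plus factors is unitary on the circle. The maximum
principle makes it constant, and at λ = 0 twisting makes it diagonal and the normalization makes it
1 (`IsIwasawaSplitting.unitary_unique`).

Explicit formula: the matrix Q is a gauge with Q⁻¹Q' + Q⁻¹YQ = (i - β₁')D - β₂'L₀. This is a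
rational identity modulo the two equations for u (`gaugePoly_identity`). As D and L₀ commute and SQ
= 1 at y = 0, it follows that SQ = exp((iy - β₁)D - β₂L₀) (`frameSol_mul_Q`). -/

noncomputable section

/-! ### Linear differential equations in a Banach algebra: Picard series and holomorphic parameters.
-/

namespace LinearODE

set_option linter.unusedSectionVars false

open intervalIntegral MeasureTheory Set Filter Topology

variable {𝔸 : Type*} [NormedRing 𝔸] [NormedAlgebra ℂ 𝔸] [CompleteSpace 𝔸]

/-- The terms of the Picard series of the linear equation `X' = X B`, `X 0 = 1`. -/
def picardTerm (B : ℝ → 𝔸) : ℕ → ℝ → 𝔸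
  | 0 => fun _ => 1
  | n + 1 => fun y => ∫ s in (0 : ℝ)..y, picardTerm B n s * B s

/-- The solution of the linear equation `X' = X B`, `X 0 = 1`. -/
def sol (B : ℝ → 𝔸) (y : ℝ) : 𝔸 := ∑' n, picardTerm B n y

theorem continuous_picardTerm {B : ℝ → 𝔸} (hB : Continuous B) (n : ℕ) :
    Continuous (picardTerm B n) := by
  induction n with
  | zero => exact continuous_const
  | succ n ih =>
    exact continuous_primitive (fun _ _ => (ih.mul hB).intervalIntegrable _ _) 0

theorem hasDerivAt_picardTerm_succ {B : ℝ → 𝔸} (hB : Continuous B) (n : ℕ) (y : ℝ) :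
    HasDerivAt (picardTerm B (n + 1)) (picardTerm B n y * B y) y := by
  have hc : Continuous fun s => picardTerm B n s * B s := (continuous_picardTerm hB n).mul hB
  exact integral_hasDerivAt_right (hc.intervalIntegrable _ _) (hc.stronglyMeasurableAtFilter _ _)
    hc.continuousAt

/-- Each integration turns |s|ⁿ into |y|ⁿ⁺¹/(n+1), which builds up the factorial. The factor ‖1‖
stays because the norm of the unit is not assumed to be 1. -/
theorem norm_picardTerm_le {B : ℝ → 𝔸} (hB : Continuous B) {M Y : ℝ}
    (hM : ∀ s, |s| ≤ Y → ‖B s‖ ≤ M) (n : ℕ) {y : ℝ} (hy : |y| ≤ Y) :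
    ‖picardTerm B n y‖ ≤ ‖(1 : 𝔸)‖ * ((M * |y|) ^ n / n.factorial) := by
  induction n generalizing y with
  | zero => simp [picardTerm]
  | succ n ih =>
    have hM0 : 0 ≤ M := (norm_nonneg _).trans (hM y hy)
    have hcont : Continuous fun s => ‖(1 : 𝔸)‖ * ((M * |s|) ^ n / n.factorial) * M := by fun_prop
    have hc : Continuous fun s => ‖picardTerm B n s * B s‖ :=
      ((continuous_picardTerm hB n).mul hB).norm
    calc ‖picardTerm B (n + 1) y‖
        ≤ ∫ s in uIoc 0 y, ‖picardTerm B n s * B s‖ := norm_integral_le_integral_norm_uIoc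
      _ ≤ ∫ s in uIoc 0 y, ‖(1 : 𝔸)‖ * ((M * |s|) ^ n / n.factorial) * M := by
          refine setIntegral_mono_on ?_ ?_ measurableSet_uIoc fun s hs => ?_
          · exact intervalIntegrable_iff.1 (hc.intervalIntegrable 0 y)
          · exact intervalIntegrable_iff.1 (hcont.intervalIntegrable 0 y)
          · have hs' : |s| ≤ Y := by
              have := abs_sub_left_of_mem_uIcc (uIoc_subset_uIcc hs)
              simp only [sub_zero] at this
              exact this.trans hy
            exact (norm_mul_le _ _).trans
              (mul_le_mul (ih hs') (hM s hs') (norm_nonneg _) (by positivity))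
      _ = ‖(1 : 𝔸)‖ * M ^ (n + 1) / n.factorial * ∫ s in uIoc 0 y, |s - 0| ^ n := by
          rw [← MeasureTheory.integral_const_mul]
          congr 1
          ext s
          rw [sub_zero, mul_pow]
          ring
      _ = ‖(1 : 𝔸)‖ * ((M * |y|) ^ (n + 1) / (n + 1).factorial) := by
          rw [integral_pow_abs_sub_uIoc, sub_zero, Nat.factorial_succ]
          push_cast
          rw [mul_pow]
          field_simp

theorem exists_norm_le_of_continuous {B : ℝ → 𝔸} (hB : Continuous B) (Y : ℝ) :
    ∃ M, ∀ s, |s| ≤ Y → ‖B s‖ ≤ M := by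
  obtain ⟨M, hM⟩ := (isCompact_Icc (a := -Y) (b := Y)).exists_bound_of_continuousOn hB.continuousOn
  exact ⟨M, fun s hs => hM s (abs_le.1 hs)⟩

theorem summable_picardBound (M Y : ℝ) :
    Summable fun n : ℕ => ‖(1 : 𝔸)‖ * ((M * Y) ^ n / n.factorial) :=
  (Real.summable_pow_div_factorial _).mul_left _

/-- Termwise differentiation: the derivative of term n + 1 is term n times B, so the differentiated
series is the original one, shifted and multiplied by B, with an exponential majorant. -/
theorem hasDerivAt_sol {B : ℝ → 𝔸} (hB : Continuous B) (y : ℝ) :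
    HasDerivAt (sol B) (sol B y * B y) y := by
  -- A slightly larger radius, so that y lies inside an open interval on which the majorant is
  -- uniform.
  set Y := |y| + 1 with hY
  obtain ⟨M, hM⟩ := exists_norm_le_of_continuous hB Y
  have hY0 : 0 < Y := by positivity
  have hM0 : 0 ≤ M := (norm_nonneg _).trans (hM 0 (by simpa using hY0.le))
  have hle : ∀ n s, |s| ≤ Y → ‖picardTerm B n s‖ ≤ ‖(1 : 𝔸)‖ * ((M * Y) ^ n / n.factorial) :=
    fun n s hs => (norm_picardTerm_le hB hM n hs).trans (by gcongr)
  have hs : ∀ s, |s| ≤ Y → Summable fun n => picardTerm B n s := fun s hs =>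
    .of_norm_bounded (summable_picardBound M Y) fun n => hle n s hs
  -- The constant term 0 has derivative 0; this causes the index shift in `g'` and `v`.
  let g' : ℕ → ℝ → 𝔸 := fun n s => n.casesOn 0 fun m => picardTerm B m s * B s
  let v : ℕ → ℝ := fun n => n.casesOn 0 fun m => ‖(1 : 𝔸)‖ * ((M * Y) ^ m / m.factorial) * M
  have hv : Summable v := by
    rw [← summable_nat_add_iff 1]
    exact (summable_picardBound (𝔸 := 𝔸) M Y).mul_right M
  have habs : ∀ s, s ∈ Ioo (-Y) Y → |s| ≤ Y := fun s hs => abs_le.2 ⟨hs.1.le, hs.2.le⟩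
  have hyY : y ∈ Ioo (-Y) Y := abs_lt.1 (by rw [hY]; linarith)
  have key := hasDerivAt_tsum_of_isPreconnected (g := picardTerm B) (g' := g') hv isOpen_Ioo
    isPreconnected_Ioo (t := Ioo (-Y) Y) (fun n s _ => by
      cases n with
      | zero => exact hasDerivAt_const s (1 : 𝔸)
      | succ n => exact hasDerivAt_picardTerm_succ hB n s)
    (fun n s hs => by
      cases n with
      | zero => simp [g', v]
      | succ n =>
        exact (norm_mul_le _ _).trans (mul_le_mul (hle n s (habs s hs)) (hM s (habs s hs))
          (norm_nonneg _) (by positivity))) hyY (hs y (habs y hyY)) hyY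
  have hsum : ∑' n, g' n y = sol B y * B y := by
    have h1 := (hs y (habs y hyY)).mul_right (B y)
    have h2 : Summable fun n => g' n y := (summable_nat_add_iff 1).1 h1
    rw [h2.tsum_eq_zero_add, sol, ← (hs y (habs y hyY)).tsum_mul_right]
    exact zero_add _
  rw [hsum] at key
  exact key

theorem sol_zero (B : ℝ → 𝔸) : sol B 0 = 1 := by
  rw [sol, tsum_eq_single 0]
  · rfl
  · intro n hn
    obtain ⟨m, rfl⟩ := Nat.exists_eq_succ_of_ne_zero hn
    exact integral_same

/-- A family of coefficients that separates the parameter and the time. -/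
def separated {ι : Type*} [Fintype ι] (φ : ι → ℂ → ℂ) (b : ι → ℝ → 𝔸) (l : ℂ) (y : ℝ) : 𝔸 :=
  ∑ i, φ i l • b i y

theorem continuous_separated {ι : Type*} [Fintype ι] {φ : ι → ℂ → ℂ} {b : ι → ℝ → 𝔸}
    (hb : ∀ i, Continuous (b i)) (l : ℂ) : Continuous (separated φ b l) :=
  continuous_finsetSum _ fun i _ => (hb i).const_smul _

/-- Separation of variables survives each Picard step: the integral acts only on the factors
depending on y, and the factors depending on λ are multiplied. Every term is thus visibly
holomorphic in λ, without differentiation under the integral sign. -/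
theorem exists_picardTerm_eq_separated {ι : Type} [Fintype ι] {φ : ι → ℂ → ℂ} {b : ι → ℝ → 𝔸}
    {Ω : Set ℂ} (hφ : ∀ i, DifferentiableOn ℂ (φ i) Ω) (hb : ∀ i, Continuous (b i)) (n : ℕ) :
    ∃ (κ : Type) (_ : Fintype κ) (γ : κ → ℂ → ℂ) (c : κ → ℝ → 𝔸),
      (∀ k, DifferentiableOn ℂ (γ k) Ω) ∧ (∀ k, Continuous (c k)) ∧
      ∀ l y, picardTerm (separated φ b l) n y = separated γ c l y := by
  induction n with
  | zero =>
    exact ⟨Unit, inferInstance, fun _ _ => 1, fun _ _ => 1, fun _ => differentiableOn_const _,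
      fun _ => continuous_const, fun l y => by simp [picardTerm, separated]⟩
  | succ n ih =>
    obtain ⟨κ, _, γ, c, hγ, hc, h⟩ := ih
    refine ⟨κ × ι, inferInstance, fun p l => γ p.1 l * φ p.2 l,
      fun p y => ∫ s in (0 : ℝ)..y, c p.1 s * b p.2 s, fun p => (hγ _).mul (hφ _), fun p =>
        continuous_primitive (fun _ _ => ((hc _).mul (hb _)).intervalIntegrable _ _) 0,
      fun l y => ?_⟩
    simp only [picardTerm, h, separated]
    rw [← Finset.univ_product_univ, Finset.sum_product]
    simp only [Finset.sum_mul_sum, smul_mul_smul_comm]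
    have hcb : ∀ k i, Continuous fun s => (γ k l * φ i l) • (c k s * b i s) := fun k i =>
      ((hc k).mul (hb i)).const_smul _
    rw [integral_finsetSum fun k _ =>
      (continuous_finsetSum _ fun i _ => hcb k i).intervalIntegrable _ _]
    refine Finset.sum_congr rfl fun k _ => ?_
    rw [integral_finsetSum fun i _ => (hcb k i).intervalIntegrable _ _]
    exact Finset.sum_congr rfl fun i _ => integral_smul _ _

/-- The Picard series is a series of holomorphic functions of λ that converges uniformly near each
point, by the factorial majorant. -/
theorem differentiableOn_sol {ι : Type} [Fintype ι] {φ : ι → ℂ → ℂ} {b : ι → ℝ → 𝔸}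
    {Ω : Set ℂ} (hΩ : IsOpen Ω) (hφ : ∀ i, DifferentiableOn ℂ (φ i) Ω)
    (hb : ∀ i, Continuous (b i)) (y : ℝ) :
    DifferentiableOn ℂ (fun l => sol (separated φ b l) y) Ω := by
  intro l₀ hl₀
  choose M hM using fun i => exists_norm_le_of_continuous (hb i) |y|
  -- Only finitely many functions φ i occur, so one neighbourhood of l₀ bounds all of them.
  have hev : ∀ᶠ l in 𝓝 l₀, l ∈ Ω ∧ ∀ i, ‖φ i l‖ < ‖φ i l₀‖ + 1 := by
    refine (hΩ.eventually_mem hl₀).and (eventually_all.2 fun i => ?_)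
    exact (((hφ i).continuousOn.continuousAt (hΩ.mem_nhds hl₀)).norm).eventually_lt_const
      (lt_add_one _)
  obtain ⟨U, hU, hUo, hlU⟩ := eventually_nhds_iff.1 hev
  have hM0 : ∀ i, 0 ≤ M i := fun i => (norm_nonneg _).trans (hM i y le_rfl)
  have hbd : ∀ l ∈ U, ∀ s, |s| ≤ |y| → ‖separated φ b l s‖ ≤ ∑ i, (‖φ i l₀‖ + 1) * M i := by
    intro l hl s hs
    refine (norm_sum_le _ _).trans (Finset.sum_le_sum fun i _ => ?_)
    rw [norm_smul]
    exact mul_le_mul ((hU l hl).2 i).le (hM i s hs) (norm_nonneg _) (by positivity)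
  refine ((Complex.differentiableOn_tsum_of_summable_norm
    (summable_picardBound (𝔸 := 𝔸) (∑ i, (‖φ i l₀‖ + 1) * M i) |y|) (fun n => ?_) hUo
    fun n l hl => norm_picardTerm_le (continuous_separated hb l) (hbd l hl) n le_rfl
    ).differentiableAt (hUo.mem_nhds hlU)).differentiableWithinAt
  obtain ⟨κ, _, γ, c, hγ, hc, h⟩ := exists_picardTerm_eq_separated hφ hb n
  simp only [h, separated]
  exact DifferentiableOn.fun_sum fun k _ =>
    ((hγ k).mono fun l hl => (hU l hl).1).smul_const _

end LinearODE

end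

noncomputable section

attribute [local instance] Matrix.linftyOpNormedRing Matrix.linftyOpNormedAlgebra

namespace MinLag

open Complex ComplexConjugate Matrix

/-! ### Linear differential equations for `3 × 3` matrices -/

theorem hasDerivAt_matrix_iff {X : ℝ → Mat3} {X' : Mat3} {t : ℝ} :
    HasDerivAt X X' t ↔ ∀ i j, HasDerivAt (fun s => X s i j) (X' i j) t := by
  refine Iff.trans ?_ (forall_congr' fun i => hasDerivAt_pi)
  exact hasDerivAt_pi (φ := fun s i => X s i) (φ' := fun i => X' i)

theorem differentiableOn_matrix_iff {X : ℂ → Mat3} {s : Set ℂ} :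
    DifferentiableOn ℂ X s ↔ ∀ i j, DifferentiableOn ℂ (fun l => X l i j) s := by
  refine Iff.trans ?_ (forall_congr' fun i => differentiableOn_pi)
  exact differentiableOn_pi (Φ := fun s i => X s i)

theorem continuous_matrix_iff {X : ℝ → Mat3} :
    Continuous X ↔ ∀ i j, Continuous (fun s => X s i j) := by
  refine Iff.trans ?_ (forall_congr' fun i => continuous_pi_iff)
  exact continuous_pi_iff (f := fun s i => X s i)

theorem hasDerivAt_transpose {X : ℝ → Mat3} {X' : Mat3} {t : ℝ} (h : HasDerivAt X X' t) :
    HasDerivAt (fun s => (X s)ᵀ) X'ᵀ t :=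
  hasDerivAt_matrix_iff.2 fun i j => hasDerivAt_matrix_iff.1 h j i

theorem hasDerivAt_conjTranspose {X : ℝ → Mat3} {X' : Mat3} {t : ℝ} (h : HasDerivAt X X' t) :
    HasDerivAt (fun s => (X s)ᴴ) X'ᴴ t :=
  hasDerivAt_matrix_iff.2 fun i j => (hasDerivAt_matrix_iff.1 h j i).star

theorem hasDerivAt_mul {X Y : ℝ → Mat3} {X' Y' : Mat3} {t : ℝ} (hX : HasDerivAt X X' t)
    (hY : HasDerivAt Y Y' t) : HasDerivAt (fun s => X s * Y s) (X' * Y t + X t * Y') t :=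
  HasDerivAt.mul hX hY

theorem hasDerivAt_const_mul {X : ℝ → Mat3} {X' : Mat3} {t : ℝ} (C : Mat3)
    (hX : HasDerivAt X X' t) : HasDerivAt (fun s => C * X s) (C * X') t :=
  HasDerivAt.const_mul C hX

theorem hasDerivAt_mul_const {X : ℝ → Mat3} {X' : Mat3} {t : ℝ} (C : Mat3)
    (hX : HasDerivAt X X' t) : HasDerivAt (fun s => X s * C) (X' * C) t :=
  HasDerivAt.mul_const hX C

theorem eq_of_hasDerivAt_zero {X : ℝ → Mat3} (h : ∀ y, HasDerivAt X 0 y) (y : ℝ) : X y = X 0 :=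
  is_const_of_deriv_eq_zero (fun y => (h y).differentiableAt) (fun y => (h y).deriv) y 0

/-- `X` solves `X' = X B`. -/
def IsSol (B X : ℝ → Mat3) : Prop := ∀ y, HasDerivAt X (X y * B y) y

/-- The derivative of XY is X(B + C)Y. Taking Y to be an adjoint, a twisted transpose or an inverse
of a solution gives unitarity, twisting and invertibility. -/
theorem IsSol.mul_eq {B C X Y : ℝ → Mat3} (hX : IsSol B X)
    (hY : ∀ y, HasDerivAt Y (C y * Y y) y) (hBC : ∀ y, B y + C y = 0) (y : ℝ) :
    X y * Y y = X 0 * Y 0 := by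
  refine eq_of_hasDerivAt_zero (X := fun s => X s * Y s) (fun s => ?_) y
  convert hasDerivAt_mul (hX s) (hY s) using 1
  rw [mul_assoc, ← mul_assoc (X s) (C s), mul_assoc (X s) (C s), ← mul_add, ← add_mul, hBC,
    zero_mul, mul_zero]

theorem IsSol.const_mul {B X : ℝ → Mat3} (hX : IsSol B X) (C : Mat3) :
    IsSol B fun y => C * X y := fun y => by
  simpa only [mul_assoc] using hasDerivAt_const_mul C (hX y)

/-- Liouville's formula: the derivative of det X is tr B · det X. -/
theorem IsSol.det_eq {B X : ℝ → Mat3} (hX : IsSol B X) (hB : ∀ y, (B y).trace = 0) (y : ℝ) :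
    (X y).det = (X 0).det := by
  have key : ∀ s, HasDerivAt (fun s => (X s).det) 0 s := by
    intro s
    have h := fun i j => hasDerivAt_matrix_iff.1 (hX s) i j
    have htr := hB s
    simp only [Matrix.trace_fin_three] at htr
    simp only [Matrix.det_fin_three]
    refine HasDerivAt.congr_deriv ((((((((h 0 0).mul (h 1 1)).mul (h 2 2)).sub (((h 0 0).mul (h 1 2)).mul (h 2 1))).sub
      (((h 0 1).mul (h 1 0)).mul (h 2 2))).add (((h 0 1).mul (h 1 2)).mul (h 2 0))).add
      (((h 0 2).mul (h 1 0)).mul (h 2 1))).sub (((h 0 2).mul (h 1 1)).mul (h 2 0))) ?_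
    simp only [Matrix.mul_apply, Fin.sum_univ_three, Pi.mul_apply]
    linear_combination ((X s 0 0 * X s 1 1 * X s 2 2 - X s 0 0 * X s 1 2 * X s 2 1
      - X s 0 1 * X s 1 0 * X s 2 2 + X s 0 1 * X s 1 2 * X s 2 0
      + X s 0 2 * X s 1 0 * X s 2 1 - X s 0 2 * X s 1 1 * X s 2 0)) * htr
  exact is_const_of_deriv_eq_zero (fun y => (key y).differentiableAt) (fun y => (key y).deriv) y 0

theorem IsSol.mul_conjTranspose_eq {B X : ℝ → Mat3} (hX : IsSol B X) (hB : ∀ y, (B y)ᴴ = -B y)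
    (y : ℝ) : X y * (X y)ᴴ = X 0 * (X 0)ᴴ := by
  refine hX.mul_eq (C := fun s => -B s) (Y := fun s => (X s)ᴴ) (fun s => ?_) (fun s => by simp) y
  simpa only [Matrix.conjTranspose_mul, hB] using hasDerivAt_conjTranspose (hX s)

theorem IsSol.mem_specialUnitaryGroup {B X : ℝ → Mat3} (hX : IsSol B X)
    (hB : ∀ y, (B y)ᴴ = -B y) (htr : ∀ y, (B y).trace = 0)
    (h0 : X 0 ∈ specialUnitaryGroup (Fin 3) ℂ) (y : ℝ) :
    X y ∈ specialUnitaryGroup (Fin 3) ℂ := by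
  rw [mem_specialUnitaryGroup_iff, mem_unitaryGroup_iff] at h0 ⊢
  rw [star_eq_conjTranspose] at h0 ⊢
  exact ⟨(hX.mul_conjTranspose_eq hB y).trans h0.1, (hX.det_eq htr y).trans h0.2⟩

/-! ### The automorphism `σ` -/

theorem twistP_mul_self : twistP * twistP = 1 := by
  have h : exp (2 * Real.pi * I / 3) * exp (2 * Real.pi * I / 3) ^ 2 = 1 := by
    rw [← pow_succ', ← Complex.exp_nat_mul, ← Complex.exp_two_pi_mul_I]
    congr 1
    push_cast
    ring
  ext i j
  fin_cases i <;> fin_cases j <;>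
    simp [twistP, Matrix.mul_apply, Fin.sum_univ_three, h, mul_comm (_ ^ 2)]

theorem twistP_inv : twistP⁻¹ = twistP := Matrix.inv_eq_right_inv twistP_mul_self

theorem sigma_mul (g h : Mat3) : sigma (g * h) = sigma g * sigma h := by
  rw [sigma, sigma, sigma, Matrix.transpose_mul, Matrix.mul_inv_rev, twistP_inv]
  simp only [mul_assoc]
  rw [← mul_assoc twistP twistP (hᵀ⁻¹ * twistP), twistP_mul_self, one_mul]

/-- As P² = 1, the relation σ(g) = h can be tested by a product without inverses, a form that can be
differentiated along solutions. -/
theorem sigma_eq_of_mul_eq_one {g h : Mat3} (H : h * twistP * gᵀ * twistP = 1) : sigma g = h := by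
  have h1 : gᵀ * (twistP * h * twistP) = 1 := by
    rw [mul_eq_one_comm]
    simp only [mul_assoc] at H ⊢
    calc twistP * (h * (twistP * gᵀ)) = twistP * (h * (twistP * (gᵀ * (twistP * twistP)))) := by
          rw [twistP_mul_self, mul_one]
      _ = twistP * (h * (twistP * (gᵀ * twistP))) * twistP := by simp only [mul_assoc]
      _ = 1 := by rw [H, mul_one, twistP_mul_self]
  rw [sigma, Matrix.inv_eq_right_inv h1, twistP_inv]
  simp only [mul_assoc]
  rw [twistP_mul_self, mul_one, ← mul_assoc, twistP_mul_self, one_mul]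

/-- The hypothesis says that the differential B ↦ -P Bᵗ P of σ sends B to B'. Then P Xᵗ P solves the
left equation with coefficient -B', so its product with X' is constant. -/
theorem IsSol.sigma_eq {B B' X X' : ℝ → Mat3} (hX : IsSol B X) (hX' : IsSol B' X')
    (hB : ∀ y, B' y * twistP = -(twistP * (B y)ᵀ)) (h1 : X 0 = 1) (h1' : X' 0 = 1) (y : ℝ) :
    sigma (X y) = X' y := by
  refine sigma_eq_of_mul_eq_one ?_
  have := hX'.mul_eq (C := fun s => twistP * (B s)ᵀ * twistP)
    (Y := fun s => twistP * ((X s)ᵀ * twistP)) (fun s => ?_) (fun s => ?_) y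
  · rw [h1, h1', transpose_one] at this
    simpa only [mul_assoc, one_mul, twistP_mul_self] using this
  · have h := hasDerivAt_const_mul twistP (hasDerivAt_mul_const twistP (hasDerivAt_transpose (hX s)))
    convert h using 1
    simp only [mul_assoc, transpose_mul]
    rw [← mul_assoc twistP twistP, twistP_mul_self, one_mul]
  · calc B' s + twistP * (B s)ᵀ * twistP = B' s * (twistP * twistP) + twistP * (B s)ᵀ * twistP := by
          rw [twistP_mul_self, mul_one]
      _ = 0 := by rw [← mul_assoc, hB, neg_mul, neg_add_cancel]

/-! ### Fundamental solutions with a parameter -/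

open LinearODE

theorem isSol_sol {B : ℝ → Mat3} (hB : Continuous B) : IsSol B (sol B) := hasDerivAt_sol hB

/-- The inverse of the fundamental solution. -/
def solInv (B : ℝ → Mat3) (y : ℝ) : Mat3 := (sol (fun s => -(B s)ᵀ) y)ᵀ

theorem continuous_neg_transpose {B : ℝ → Mat3} (hB : Continuous B) :
    Continuous fun s => -(B s)ᵀ :=
  continuous_matrix_iff.2 fun i j => (continuous_matrix_iff.1 hB j i).neg

/-- The inverse satisfies an equation with the coefficient on the left; transposing moves it to the
right, where the Picard series and its holomorphy in parameters apply. -/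
theorem hasDerivAt_solInv {B : ℝ → Mat3} (hB : Continuous B) (y : ℝ) :
    HasDerivAt (solInv B) (-B y * solInv B y) y := by
  have h := hasDerivAt_transpose (isSol_sol (continuous_neg_transpose hB) y)
  rwa [transpose_mul, transpose_neg, transpose_transpose] at h

theorem solInv_zero (B : ℝ → Mat3) : solInv B 0 = 1 := by
  rw [solInv, sol_zero, transpose_one]

theorem sol_mul_solInv {B : ℝ → Mat3} (hB : Continuous B) (y : ℝ) :
    sol B y * solInv B y = 1 := by
  rw [(isSol_sol hB).mul_eq (hasDerivAt_solInv hB) (fun s => add_neg_cancel _) y, sol_zero,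
    solInv_zero, one_mul]

theorem solInv_mul_sol {B : ℝ → Mat3} (hB : Continuous B) (y : ℝ) :
    solInv B y * sol B y = 1 := mul_eq_one_comm.1 (sol_mul_solInv hB y)

theorem differentiableOn_solInv {ι : Type} [Fintype ι] {φ : ι → ℂ → ℂ} {b : ι → ℝ → Mat3}
    {Ω : Set ℂ} (hΩ : IsOpen Ω) (hφ : ∀ i, DifferentiableOn ℂ (φ i) Ω)
    (hb : ∀ i, Continuous (b i)) (y : ℝ) :
    DifferentiableOn ℂ (fun l => solInv (separated φ b l) y) Ω := by
  have h := differentiableOn_sol hΩ hφ (fun i => continuous_neg_transpose (hb i)) y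
  refine differentiableOn_matrix_iff.2 fun i j => ?_
  convert differentiableOn_matrix_iff.1 h j i using 3 with l
  rw [solInv, transpose_apply]
  refine congrArg (fun B : ℝ → Mat3 => sol B y j i) (funext fun s => ?_)
  simp only [separated, transpose_sum, transpose_smul, smul_neg, Finset.sum_neg_distrib]

end MinLag
end

noncomputable section

namespace MinLag

open Complex ComplexConjugate

/-! ### The amplitude function and `sn` -/

theorem one_sub_mul_sin_sq_pos {m : ℝ} (hm : m < 1) (θ : ℝ) : 0 < 1 - m * Real.sin θ ^ 2 := by
  rcases le_total m 0 with h | h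
  · nlinarith [sq_nonneg (Real.sin θ)]
  · nlinarith [Real.sin_sq_le_one θ]

theorem continuous_ellipticIntegrand {m : ℝ} (hm : m < 1) :
    Continuous fun α => 1 / Real.sqrt (1 - m * Real.sin α ^ 2) := by
  refine Continuous.div continuous_const (by fun_prop) fun α => ?_
  exact (Real.sqrt_pos.2 (one_sub_mul_sin_sq_pos hm α)).ne'

theorem hasDerivAt_ellipticJ {m : ℝ} (hm : m < 1) (θ : ℝ) :
    HasDerivAt (ellipticJ m) (1 / Real.sqrt (1 - m * Real.sin θ ^ 2)) θ :=
  (continuous_ellipticIntegrand hm).integral_hasStrictDerivAt 0 θ |>.hasDerivAt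

theorem strictMono_ellipticJ {m : ℝ} (hm : m < 1) : StrictMono (ellipticJ m) :=
  strictMono_of_deriv_pos fun θ => by
    rw [(hasDerivAt_ellipticJ hm θ).deriv]
    exact one_div_pos.2 (Real.sqrt_pos.2 (one_sub_mul_sin_sq_pos hm θ))

theorem ellipticJ_zero (m : ℝ) : ellipticJ m 0 = 0 := intervalIntegral.integral_same

/-- The integrand is at least c = 1/√(1 + |m|), so J(θ) - cθ is monotone and J grows at least
linearly in both directions. The bound also covers negative m = k². -/
theorem surjective_ellipticJ {m : ℝ} (hm : m < 1) : Function.Surjective (ellipticJ m) := by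
  have hδ : 0 < 1 / Real.sqrt (1 + |m|) := by positivity
  have hle : ∀ θ, 1 / Real.sqrt (1 + |m|) ≤ 1 / Real.sqrt (1 - m * Real.sin θ ^ 2) := fun θ => by
    refine one_div_le_one_div_of_le (Real.sqrt_pos.2 (one_sub_mul_sin_sq_pos hm θ))
      (Real.sqrt_le_sqrt ?_)
    nlinarith [Real.sin_sq_le_one θ, sq_nonneg (Real.sin θ), neg_abs_le m, abs_nonneg m]
  have hmono : Monotone fun θ => ellipticJ m θ - 1 / Real.sqrt (1 + |m|) * θ := by
    have hd : ∀ θ, HasDerivAt (fun θ => ellipticJ m θ - 1 / Real.sqrt (1 + |m|) * θ)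
        (1 / Real.sqrt (1 - m * Real.sin θ ^ 2) - 1 / Real.sqrt (1 + |m|) * 1) θ := fun θ =>
      (hasDerivAt_ellipticJ hm θ).sub ((hasDerivAt_id θ).const_mul _)
    refine monotone_of_deriv_nonneg (fun θ => (hd θ).differentiableAt) fun θ => ?_
    rw [(hd θ).deriv, mul_one]
    exact sub_nonneg.2 (hle θ)
  have hcont : Continuous (ellipticJ m) :=
    continuous_iff_continuousAt.2 fun θ => (hasDerivAt_ellipticJ hm θ).continuousAt
  refine hcont.surjective ?_ ?_
  · refine Filter.tendsto_atTop_mono' _ ?_ (Filter.tendsto_id.const_mul_atTop hδ)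
    filter_upwards [Filter.eventually_ge_atTop 0] with θ hθ
    have := hmono hθ
    simp only [ellipticJ_zero, mul_zero, sub_zero] at this
    exact sub_nonneg.1 this
  · refine Filter.tendsto_atBot_mono' _ ?_ (Filter.tendsto_id.const_mul_atBot hδ)
    filter_upwards [Filter.eventually_le_atBot 0] with θ hθ
    have := hmono hθ
    simp only [ellipticJ_zero, mul_zero, sub_zero] at this
    exact sub_nonpos.1 this

/-- The Jacobi amplitude, the inverse function of the elliptic integral. -/
def jacobiAm (m x : ℝ) : ℝ := Function.invFun (ellipticJ m) x

theorem ellipticJ_jacobiAm {m : ℝ} (hm : m < 1) (x : ℝ) : ellipticJ m (jacobiAm m x) = x :=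
  Function.rightInverse_invFun (surjective_ellipticJ hm) x

theorem jacobiAm_zero {m : ℝ} (hm : m < 1) : jacobiAm m 0 = 0 :=
  (strictMono_ellipticJ hm).injective (by rw [ellipticJ_jacobiAm hm, ellipticJ_zero])

/-- A strictly increasing surjection of ℝ is an order isomorphism, hence a homeomorphism. -/
theorem continuous_jacobiAm {m : ℝ} (hm : m < 1) : Continuous (jacobiAm m) := by
  let e := (strictMono_ellipticJ hm).orderIsoOfSurjective _ (surjective_ellipticJ hm)
  have h : jacobiAm m = e.symm := funext fun x => by
    rw [OrderIso.eq_symm_apply]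
    exact ellipticJ_jacobiAm hm x
  rw [h]
  exact e.symm.continuous

theorem hasDerivAt_jacobiAm {m : ℝ} (hm : m < 1) (x : ℝ) :
    HasDerivAt (jacobiAm m) (Real.sqrt (1 - m * Real.sin (jacobiAm m x) ^ 2)) x := by
  have h := HasDerivAt.of_local_left_inverse (continuous_jacobiAm hm).continuousAt
    (hasDerivAt_ellipticJ hm (jacobiAm m x)) (one_div_pos.2 (Real.sqrt_pos.2
      (one_sub_mul_sin_sq_pos hm _))).ne' (.of_forall (ellipticJ_jacobiAm hm))
  rwa [one_div, inv_inv] at h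

/-! ### The conformal factor -/

theorem norm_psi (a b : ℂ) : ‖psi a b‖ = ‖a‖ ^ 2 * ‖b‖ := by simp [psi]

theorem a1_pos {a : ℂ} (ha : a ≠ 0) : 0 < a1 a := by
  rw [a1]
  positivity

theorem betaConst_eq {a : ℂ} (ha : a ≠ 0) (b : ℂ) : betaConst a b = 2 * a1 a + ‖b‖ ^ 2 := by
  have := norm_pos_iff.2 ha
  rw [betaConst, norm_psi, a1]
  field_simp

theorem a2_sub_a3 {a : ℂ} (ha : a ≠ 0) (b : ℂ) : a2 a b - a3 a b = ‖b‖ ^ 2 / 2 := by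
  rw [a2, a3, betaConst_eq ha]
  ring

/-- With `a2_sub_a3` these are Vieta's relations: for h = |b|²/2, the numbers a₂ and -a₃ are the
roots of t² - ht - a₁h. Multiplied by -8(t - a₁), this quadratic is the cubic -8t³ + 4βt² - 4|ψ|².
-/
theorem a2_mul_a3 {a : ℂ} (ha : a ≠ 0) (b : ℂ) : a2 a b * a3 a b = a1 a * ‖b‖ ^ 2 / 2 := by
  have h := a1_pos ha
  rw [a2, a3, betaConst_eq ha, show (2 * a1 a + ‖b‖ ^ 2) / 2 - a1 a = ‖b‖ ^ 2 / 2 by ring]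
  have := Real.sq_sqrt (show 0 ≤ (‖b‖ ^ 2 / 2) ^ 2 + 4 * a1 a * (‖b‖ ^ 2 / 2) by positivity)
  linear_combination this / 4

theorem a2_pos {a b : ℂ} (ha : a ≠ 0) (hb : b ≠ 0) : 0 < a2 a b := by
  have h := a1_pos ha
  have := norm_pos_iff.2 hb
  rw [a2, betaConst_eq ha, show (2 * a1 a + ‖b‖ ^ 2) / 2 - a1 a = ‖b‖ ^ 2 / 2 by ring]
  positivity

theorem a3_pos {a b : ℂ} (ha : a ≠ 0) (hb : b ≠ 0) : 0 < a3 a b := by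
  have h := a1_pos ha
  have h' := norm_pos_iff.2 hb
  refine pos_of_mul_pos_right (a := a2 a b) ?_ (a2_pos ha hb).le
  rw [a2_mul_a3 ha]
  positivity

theorem kSq_lt_one {a b : ℂ} (ha : a ≠ 0) (hb : b ≠ 0) : kSq a b < 1 := by
  have := a1_pos ha
  have := a2_pos ha hb
  have := a3_pos ha hb
  rw [kSq, div_lt_one (by linarith)]
  linarith

theorem conformalFactor_eq {a : ℂ} (ha : a ≠ 0) (b : ℂ) (y : ℝ) : conformalFactor a b y =
    a1 a - (a1 a - a2 a b) * Real.sin (jacobiAm (kSq a b) (rConst a b * y)) ^ 2 := by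
  have := (a1_pos ha).ne'
  rw [conformalFactor, qSq, jacobiSn, jacobiAm]
  field_simp

/-- The conformal factor is a convex combination of a₁ and a₂, with weights cos² and sin² of the
amplitude. -/
theorem conformalFactor_pos {a b : ℂ} (ha : a ≠ 0) (hb : b ≠ 0) (y : ℝ) :
    0 < conformalFactor a b y := by
  rw [conformalFactor_eq ha]
  have := a1_pos ha
  have := a2_pos ha hb
  set s := Real.sin (jacobiAm (kSq a b) (rConst a b * y)) with hs
  have h1 : s ^ 2 ≤ 1 := Real.sin_sq_le_one _
  rcases eq_or_lt_of_le h1 with h | h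
  · rw [h]; linarith
  · nlinarith [sq_nonneg s]

theorem conformalFactor_le {a b : ℂ} (ha : a ≠ 0) (hb : b ≠ 0) (y : ℝ) :
    conformalFactor a b y ≤ a1 a + a2 a b := by
  rw [conformalFactor_eq ha]
  have := a1_pos ha
  have := a2_pos ha hb
  set s := Real.sin (jacobiAm (kSq a b) (rConst a b * y)) with hs
  have h1 : s ^ 2 ≤ 1 := Real.sin_sq_le_one _
  nlinarith [sq_nonneg s]

theorem conformalFactor_zero {a b : ℂ} (ha : a ≠ 0) (hb : b ≠ 0) :
    conformalFactor a b 0 = a1 a := by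
  simp [conformalFactor_eq ha, jacobiAm_zero (kSq_lt_one ha hb)]

/-- The derivative of the conformal factor. -/
def conformalDeriv (a b : ℂ) (y : ℝ) : ℝ :=
  -2 * (a1 a - a2 a b) * rConst a b * (Real.sin (jacobiAm (kSq a b) (rConst a b * y)) *
    Real.cos (jacobiAm (kSq a b) (rConst a b * y)) *
    Real.sqrt (1 - kSq a b * Real.sin (jacobiAm (kSq a b) (rConst a b * y)) ^ 2))

theorem hasDerivAt_am_mul {a b : ℂ} (ha : a ≠ 0) (hb : b ≠ 0) (y : ℝ) :
    HasDerivAt (fun y => jacobiAm (kSq a b) (rConst a b * y))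
      (Real.sqrt (1 - kSq a b * Real.sin (jacobiAm (kSq a b) (rConst a b * y)) ^ 2) *
        (rConst a b * 1)) y :=
  (hasDerivAt_jacobiAm (kSq_lt_one ha hb) _).comp y ((hasDerivAt_id y).const_mul _)

theorem hasDerivAt_conformalFactor {a b : ℂ} (ha : a ≠ 0) (hb : b ≠ 0) (y : ℝ) :
    HasDerivAt (conformalFactor a b) (conformalDeriv a b y) y := by
  rw [show conformalFactor a b = _ from funext (conformalFactor_eq ha b)]
  refine HasDerivAt.congr_deriv
    (((((hasDerivAt_am_mul ha hb y).sin).pow 2).const_mul (a1 a - a2 a b)).const_sub (a1 a)) ?_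
  rw [conformalDeriv]
  push_cast
  ring

theorem rConst_sq {a b : ℂ} (ha : a ≠ 0) (hb : b ≠ 0) :
    rConst a b ^ 2 = 2 * (a1 a + a3 a b) := by
  have := a1_pos ha
  have := a3_pos ha hb
  rw [rConst, Real.sq_sqrt (by linarith)]

theorem kSq_mul {a b : ℂ} (ha : a ≠ 0) (hb : b ≠ 0) :
    kSq a b * (a1 a + a3 a b) = a1 a - a2 a b := by
  have := a1_pos ha
  have := a3_pos ha hb
  rw [kSq, div_mul_cancel₀ _ (by linarith)]

theorem conformalDeriv_zero {a b : ℂ} (ha : a ≠ 0) (hb : b ≠ 0) : conformalDeriv a b 0 = 0 := by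
  simp [conformalDeriv, jacobiAm_zero (kSq_lt_one ha hb)]

/-- With s, c the sine and cosine of the amplitude and Δ² = 1 - k²s², the three factors of the cubic
are a₁ - w = (a₁ - a₂)s², w - a₂ = (a₁ - a₂)c² and w + a₃ = (a₁ + a₃)Δ². Their product is w'² up to
the factor 8. -/
theorem conformalDeriv_sq {a b : ℂ} (ha : a ≠ 0) (hb : b ≠ 0) (y : ℝ) :
    conformalDeriv a b y ^ 2 = -8 * conformalFactor a b y ^ 3
      + 4 * betaConst a b * conformalFactor a b y ^ 2 - 4 * ‖psi a b‖ ^ 2 := by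
  rw [conformalDeriv, conformalFactor_eq ha, betaConst_eq ha, norm_psi]
  have hr := rConst_sq ha hb
  have hk := kSq_mul ha hb
  have h1 := a2_sub_a3 ha b
  have h2 := a2_mul_a3 ha b
  have hΔ := Real.sq_sqrt
    (one_sub_mul_sin_sq_pos (kSq_lt_one ha hb) (jacobiAm (kSq a b) (rConst a b * y))).le
  have hsc := Real.sin_sq_add_cos_sq (jacobiAm (kSq a b) (rConst a b * y))
  have hb2 : ‖b‖ ^ 2 = 2 * (a2 a b - a3 a b) := by linarith
  have ha2 : ‖a‖ ^ 2 = a1 a := rfl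
  rw [mul_pow ( ‖a‖ ^ 2), ha2, hb2]
  rw [hb2] at h2
  generalize jacobiAm (kSq a b) (rConst a b * y) = θ at *
  generalize Real.sqrt (1 - kSq a b * Real.sin θ ^ 2) = Δ at *
  generalize Real.sin θ = s at *
  generalize Real.cos θ = c at *
  have hc : c ^ 2 = 1 - s ^ 2 := by linarith
  -- This is r²Δ² = 2(w + a₃).
  have hrΔ : rConst a b ^ 2 * Δ ^ 2 = 2 * ((a1 a + a3 a b) - (a1 a - a2 a b) * s ^ 2) := by
    rw [hr, hΔ]
    linear_combination -2 * s ^ 2 * hk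
  calc _ = 4 * (a1 a - a2 a b) ^ 2 * s ^ 2 * c ^ 2 * (rConst a b ^ 2 * Δ ^ 2) := by ring
    _ = 4 * (a1 a - a2 a b) ^ 2 * s ^ 2 * (1 - s ^ 2) *
        (2 * ((a1 a + a3 a b) - (a1 a - a2 a b) * s ^ 2)) := by rw [hrΔ, hc]
    _ = _ := by
      linear_combination (8 * (a1 a - (a1 a - a2 a b) * s ^ 2) - 8 * a1 a) * h2

/-- Differentiating the first-order equation would give this only after division by w', which
vanishes at some points (everywhere if |a| = |b|), so the formula for w' is differentiated directly.
-/
theorem hasDerivAt_conformalDeriv {a b : ℂ} (ha : a ≠ 0) (hb : b ≠ 0) (y : ℝ) :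
    HasDerivAt (conformalDeriv a b) (-12 * conformalFactor a b y ^ 2
      + 4 * betaConst a b * conformalFactor a b y) y := by
  have hθ := hasDerivAt_am_mul ha hb y
  have hpos := one_sub_mul_sin_sq_pos (kSq_lt_one ha hb) (jacobiAm (kSq a b) (rConst a b * y))
  have hs := hθ.sin
  have hd := (((hs.pow 2).const_mul (kSq a b)).const_sub 1).sqrt hpos.ne'
  refine HasDerivAt.congr_deriv
    (((hs.mul hθ.cos).mul hd).const_mul (-2 * (a1 a - a2 a b) * rConst a b)) ?_
  simp only [Pi.mul_apply, Pi.pow_apply]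
  clear hd hs hθ
  rw [conformalFactor_eq ha, betaConst_eq ha]
  have hr := rConst_sq ha hb
  have hk := kSq_mul ha hb
  have h1 := a2_sub_a3 ha b
  have hsc := Real.sin_sq_add_cos_sq (jacobiAm (kSq a b) (rConst a b * y))
  have hb2 : ‖b‖ ^ 2 = 2 * (a2 a b - a3 a b) := by linarith
  have hΔ := Real.sq_sqrt hpos.le
  have hΔ0 := (Real.sqrt_pos.2 hpos).ne'
  have h2 := a2_mul_a3 ha b
  rw [hb2] at h2 ⊢
  generalize jacobiAm (kSq a b) (rConst a b * y) = θ at *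
  generalize Real.sqrt (1 - kSq a b * Real.sin θ ^ 2) = Δ at *
  generalize Real.sin θ = s at *
  generalize Real.cos θ = c at *
  have hc : c ^ 2 = 1 - s ^ 2 := by linarith
  have hrΔ : rConst a b ^ 2 * Δ ^ 2 = 2 * ((a1 a + a3 a b) - (a1 a - a2 a b) * s ^ 2) := by
    rw [hr, hΔ]
    linear_combination -2 * s ^ 2 * hk
  have hrk : rConst a b ^ 2 * kSq a b = 2 * (a1 a - a2 a b) := by
    rw [hr]
    linear_combination 2 * hk
  calc _ = -2 * (a1 a - a2 a b) * ((c ^ 2 - s ^ 2) * (rConst a b ^ 2 * Δ ^ 2)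
        - s ^ 2 * c ^ 2 * (rConst a b ^ 2 * kSq a b)) := by
        push_cast
        field_simp
        ring
    _ = -2 * (a1 a - a2 a b) * ((1 - s ^ 2 - s ^ 2) *
        (2 * ((a1 a + a3 a b) - (a1 a - a2 a b) * s ^ 2))
        - s ^ 2 * (1 - s ^ 2) * (2 * (a1 a - a2 a b))) := by rw [hrΔ, hrk, hc]
    _ = _ := by linear_combination 4 * h2

/-! ### The function `u` -/

theorem exp_u {a b : ℂ} (ha : a ≠ 0) (hb : b ≠ 0) (y : ℝ) :
    Real.exp (u a b y) = conformalFactor a b y := Real.exp_log (conformalFactor_pos ha hb y)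

theorem exp_u_zero {a b : ℂ} (ha : a ≠ 0) (hb : b ≠ 0) : Real.exp (u a b 0) = ‖a‖ ^ 2 := by
  rw [exp_u ha hb, conformalFactor_zero ha hb, a1]

theorem hasDerivAt_u' {a b : ℂ} (ha : a ≠ 0) (hb : b ≠ 0) (y : ℝ) :
    HasDerivAt (u a b) (conformalDeriv a b y / conformalFactor a b y) y :=
  (hasDerivAt_conformalFactor ha hb y).log (conformalFactor_pos ha hb y).ne'

theorem differentiable_u {a b : ℂ} (ha : a ≠ 0) (hb : b ≠ 0) : Differentiable ℝ (u a b) :=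
  fun y => (hasDerivAt_u' ha hb y).differentiableAt

theorem deriv_u {a b : ℂ} (ha : a ≠ 0) (hb : b ≠ 0) (y : ℝ) :
    deriv (u a b) y = conformalDeriv a b y / conformalFactor a b y := (hasDerivAt_u' ha hb y).deriv

theorem exp_mul_deriv_u {a b : ℂ} (ha : a ≠ 0) (hb : b ≠ 0) (y : ℝ) :
    Real.exp (u a b y) * deriv (u a b) y = conformalDeriv a b y := by
  rw [deriv_u ha hb, exp_u ha hb, mul_div_cancel₀ _ (conformalFactor_pos ha hb y).ne']

theorem deriv_u_zero {a b : ℂ} (ha : a ≠ 0) (hb : b ≠ 0) : deriv (u a b) 0 = 0 := by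
  rw [deriv_u ha hb, conformalDeriv_zero ha hb, zero_div]

theorem deriv_u_sq {a b : ℂ} (ha : a ≠ 0) (hb : b ≠ 0) (y : ℝ) :
    Real.exp (u a b y) ^ 2 * deriv (u a b) y ^ 2 = -8 * Real.exp (u a b y) ^ 3
      + 4 * (2 * ‖a‖ ^ 2 + ‖b‖ ^ 2) * Real.exp (u a b y) ^ 2 - 4 * (‖a‖ ^ 2 * ‖b‖) ^ 2 := by
  rw [← mul_pow, exp_mul_deriv_u ha hb, conformalDeriv_sq ha hb, exp_u ha hb, betaConst_eq ha,
    norm_psi, a1]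

/-- In u'' = (w''w - w'²)/w² the terms with β cancel. The result is the Gauss equation of the
surface, needed for integrability. -/
theorem hasDerivAt_deriv_u {a b : ℂ} (ha : a ≠ 0) (hb : b ≠ 0) (y : ℝ) :
    HasDerivAt (deriv (u a b)) (4 * ((‖a‖ ^ 2 * ‖b‖) ^ 2 * Real.exp (u a b y) ^ (-2 : ℤ)
      - Real.exp (u a b y))) y := by
  have hw := conformalFactor_pos ha hb y
  rw [show deriv (u a b) = _ from funext (deriv_u ha hb)]
  refine ((hasDerivAt_conformalDeriv ha hb y).div (hasDerivAt_conformalFactor ha hb y)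
    hw.ne').congr_deriv ?_
  have h := conformalDeriv_sq ha hb y
  rw [norm_psi] at h
  rw [exp_u ha hb, zpow_neg, zpow_ofNat]
  field_simp
  linear_combination -h

end MinLag
end

noncomputable section

namespace MinLag

open Complex ComplexConjugate Matrix

/-! ### The algebraic identity behind the explicit formula -/

/-- The matrix of the functions `p̌, q̌, …, č` as a function of `a`, `A = ā`, `b`, `B = b̄`, `λ`,
`w = eᵘ` and `v = u'`. -/
def gaugePoly (a A b B l w v : ℂ) : Mat3 :=
  !![-(a * A) * (v / 2) + l ^ 3 * (I * A ^ 2 * B) * (a * A) * w⁻¹ - (l ^ 3)⁻¹ * (-I * a ^ 2 * b),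
     (l ^ 2)⁻¹ * a / A * (v / 2 * (a * A) - l ^ 3 * (I * A ^ 2 * B) * w⁻¹ * (a * A - w)),
     -2 * I * l⁻¹ * a * (a * A - w);
     l ^ 2 / a ^ 2 * (a * A * (v / 2) * w + (l ^ 3)⁻¹ * (-I * a ^ 2 * b) * (a * A - w)),
     1 / (a * A) * (-(a * A) * (v / 2) * w + l ^ 3 * (I * A ^ 2 * B) * w
       - (l ^ 3)⁻¹ * (-I * a ^ 2 * b) * (a * A)),
     -2 * I * l * a⁻¹ * w * (a * A - w);
     0, 0, l ^ 3 * (I * A ^ 2 * B) - (l ^ 3)⁻¹ * (-I * a ^ 2 * b) - w * v]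

/-- The derivative of `gaugePoly` if `w' = w v` and `v' = v₁`. -/
def gaugePolyDeriv (a A b B l w v v₁ : ℂ) : Mat3 :=
  !![-(a * A) * (v₁ / 2) - l ^ 3 * (I * A ^ 2 * B) * (a * A) * (v / w),
     (l ^ 2)⁻¹ * a / A * (v₁ / 2 * (a * A) + l ^ 3 * (I * A ^ 2 * B) * (a * A) * (v / w)),
     2 * I * l⁻¹ * a * (w * v);
     l ^ 2 / a ^ 2 * (a * A * (v₁ * w + v * (w * v)) / 2 - (l ^ 3)⁻¹ * (-I * a ^ 2 * b) * (w * v)),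
     1 / (a * A) * (-(a * A) * (v₁ * w + v * (w * v)) / 2 + l ^ 3 * (I * A ^ 2 * B) * (w * v)),
     -2 * I * l * a⁻¹ * (w * v * (a * A) - 2 * w * (w * v));
     0, 0, -(w * v * v + w * v₁)]

/-- `Q₀⁻¹ (i (U - V)) Q₀`. -/
def gaugeB (a A b B l w : ℂ) : Mat3 :=
  !![0, a ^ 2 * l * (I * A ^ 2 * B) / w ^ 2, I * a / l;
     -(-I * a ^ 2 * b) / (a ^ 2 * l), 0, I * w * l / a;
     I * l * w / a, I * a / l, 0]

theorem L0_eq (a b l : ℂ) (hl : l ≠ 0) : L0 a b l =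
    !![(a * conj a - b * conj b) / 3, a ^ 2 / l ^ 2, l ^ 2 * conj a * conj b;
       l ^ 2 * conj a ^ 2, (a * conj a - b * conj b) / 3, a * b / l ^ 2;
       a * b / l ^ 2, l ^ 2 * conj a * conj b, -2 * (a * conj a - b * conj b) / 3] := by
  rw [L0, pow_two, potential, Matrix.mul_fin_three, Matrix.trace_fin_three]
  ext i j
  fin_cases i <;> fin_cases j <;>
    simp <;> field_simp <;> ring

/-- Let G be `gaugePoly`. With Q = (λ³/κ) Q₀G, Q₀⁻¹Q₀' = diag(v/2, -v/2, 0) and κ'/κ = (2/3) č'/č,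
this is Q' + YQ = Q((i - β₁')D - β₂'L₀) after removing Q₀ and the scalar and multiplying by č. The
conjugates A, B are independent variables. After v₁ is eliminated, the two sides differ in each
entry by a multiple of the first-order equation for w. -/
theorem gaugePoly_identity {a A b B l w v v₁ : ℂ} (ha : a ≠ 0) (hA : A ≠ 0) (hl : l ≠ 0)
    (hw : w ≠ 0) (hv₁ : v₁ = 4 * ((a * A) ^ 2 * (b * B) / w ^ 2 - w))
    (hv : w ^ 2 * v ^ 2 = -8 * w ^ 3 + 4 * (2 * (a * A) + b * B) * w ^ 2
      - 4 * ((a * A) ^ 2 * (b * B))) :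
    gaugePoly a A b B l w v 2 2 • (!![v / 2, 0, 0; 0, -v / 2, 0; 0, 0, 0] * gaugePoly a A b B l w v
      + gaugePolyDeriv a A b B l w v v₁ + gaugeB a A b B l w * gaugePoly a A b B l w v)
      - (2 / 3 * gaugePolyDeriv a A b B l w v v₁ 2 2) • gaugePoly a A b B l w v =
    gaugePoly a A b B l w v * ((I * gaugePoly a A b B l w v 2 2
        - (2 * I * l ^ 3 * (I * A ^ 2 * B) - I * v * w)) •
        !![0, -l * B, l⁻¹ * a; l⁻¹ * b, 0, -l * A; -l * A, l⁻¹ * a, 0]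
      - (2 * w) • !![(a * A - b * B) / 3, a ^ 2 / l ^ 2, l ^ 2 * A * B;
          l ^ 2 * A ^ 2, (a * A - b * B) / 3, a * b / l ^ 2;
          a * b / l ^ 2, l ^ 2 * A * B, -2 * (a * A - b * B) / 3]) := by
  subst hv₁
  ext i j
  simp only [gaugePoly, gaugePolyDeriv, gaugeB, Matrix.mul_fin_three, Matrix.sub_apply,
    Matrix.smul_apply, Matrix.add_apply, smul_eq_mul, Matrix.mul_apply, Fin.sum_univ_three]
  fin_cases i <;> fin_cases j <;>
    simp only [Fin.zero_eta, Fin.mk_one, Fin.reduceFinMk, Matrix.of_apply, Matrix.cons_val]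
  · linear_combination (norm := (field_simp; ring_nf; simp only [I_sq, I_pow_three]; try ring))
      (-(1/12) * a * A * v / w + (5/12) * I * a * A ^ 3 * B * l ^ 3 / w ^ 2 + (1/6) * I * a ^ 2 * b / (l ^ 3 * w) - (1/4) * I * a ^ 3 * A * b / (l ^ 3 * w ^ 2)) * hv
  · linear_combination (norm := (field_simp; ring_nf; simp only [I_sq, I_pow_three]; try ring))
      ((1/6) * I * a * A * B * l / w + (1/12) * a ^ 2 * v / (l ^ 2 * w) - (5/12) * I * a ^ 2 * A ^ 2 * B * l / w ^ 2 + (1/4) * I * a ^ 4 * b / (l ^ 5 * w ^ 2)) * hv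
  · linear_combination (norm := (field_simp; ring_nf; simp only [I_sq, I_pow_three]; try ring))
      ((-2/3) * I * a / l - (1/3) * I * a ^ 2 * A / (l * w)) * hv
  · linear_combination (norm := (field_simp; ring_nf; simp only [I_sq, I_pow_three]; try ring))
      ((1/12) * A * l ^ 2 * v / a + (1/4) * I * A ^ 3 * B * l ^ 5 / (a * w) + (1/6) * I * b / l - (5/12) * I * a * A * b / (l * w)) * hv
  · linear_combination (norm := (field_simp; ring_nf; simp only [I_sq, I_pow_three]; try ring))
      ((1/6) * I * A * B * l ^ 3 / a - (1/12) * v - (1/4) * I * A ^ 2 * B * l ^ 3 / w + (5/12) * I * a ^ 2 * b / (l ^ 3 * w)) * hv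
  · linear_combination (norm := (field_simp; ring_nf; simp only [I_sq, I_pow_three]; try ring))
      ((-2/3) * I * l * w / a - (1/3) * I * A * l) * hv
  -- The last row of G is (0, 0, č), so in this entry and the next the sides agree without using the
  -- first-order equation.
  · linear_combination (norm := (field_simp; ring_nf; simp only [I_sq, I_pow_three]; try ring))
      (0 : ℂ) * hv
  · linear_combination (norm := (field_simp; ring_nf; simp only [I_sq, I_pow_three]; try ring))
      (0 : ℂ) * hv
  · linear_combination (norm := (field_simp; ring_nf; simp only [I_sq, I_pow_three]; try ring))
      ((1/3) * v - (1/3) * I * A ^ 2 * B * l ^ 3 / w - (1/3) * I * a ^ 2 * b / (l ^ 3 * w)) * hv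

end MinLag
end

noncomputable section

namespace MinLag

open Complex ComplexConjugate Matrix

/-! ### The coefficient matrices of the frame equations -/

/-- The coefficient `U₋₁` of `λ⁻¹` in the frame equations. -/
def frameU1 (a b : ℂ) (y : ℝ) : Mat3 :=
  !![0, 0, I * Real.exp (u a b y / 2);
     -I * psi a b * Real.exp (-u a b y), 0, 0;
     0, I * Real.exp (u a b y / 2), 0]

/-- The coefficient `V₁` of `λ` in the frame equations. -/
def frameV1 (a b : ℂ) (y : ℝ) : Mat3 :=
  !![0, -I * conj (psi a b) * Real.exp (-u a b y), 0;
     0, 0, I * Real.exp (u a b y / 2);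
     I * Real.exp (u a b y / 2), 0, 0]

/-- The coefficients `U₀ = V₀` of `λ⁰` in the frame equations. -/
def frameDiag (a b : ℂ) (y : ℝ) : Mat3 :=
  !![-I * du a b y / 4, 0, 0; 0, I * du a b y / 4, 0; 0, 0, 0]

/-- The coefficient matrix in the direction `x`. -/
def frameX (a b l : ℂ) (y : ℝ) : Mat3 :=
  l⁻¹ • frameU1 a b y + l • frameV1 a b y + (2 : ℂ) • frameDiag a b y

/-- The coefficient matrix in the direction `y`. -/
def frameY (a b l : ℂ) (y : ℝ) : Mat3 := (I * l⁻¹) • frameU1 a b y + (-I * l) • frameV1 a b y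

/-- The coefficient matrix of the inverse of the plus factor. -/
def framePlus (a b l : ℂ) (y : ℝ) : Mat3 :=
  (-2 * I * l) • frameV1 a b y + (-2 * I) • frameDiag a b y

/-- The terms in λ⁻¹ cancel. The polynomial dependence on λ that remains makes the plus factor
holomorphic in the disc. -/
theorem frameY_sub_frameX (a b l : ℂ) (y : ℝ) :
    frameY a b l y - I • frameX a b l y = framePlus a b l y := by
  simp only [frameX, frameY, framePlus]
  module

theorem hasFDerivAt_comp_im {g : ℝ → ℂ} {g' : ℂ} {z : ℂ} (h : HasDerivAt g g' z.im) :
    HasFDerivAt (fun w : ℂ => g w.im) (imCLM.smulRight g') z := by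
  refine HasFDerivAt.congr_fderiv
    (HasFDerivAt.comp (f := fun w : ℂ => w.im) z h.hasFDerivAt imCLM.hasFDerivAt) ?_
  ext
  simp

theorem hasFDerivAt_comp_re {g : ℝ → ℂ} {g' : ℂ} {z : ℂ} (h : HasDerivAt g g' z.re) :
    HasFDerivAt (fun w : ℂ => g w.re) (reCLM.smulRight g') z := by
  refine HasFDerivAt.congr_fderiv
    (HasFDerivAt.comp (f := fun w : ℂ => w.re) z h.hasFDerivAt reCLM.hasFDerivAt) ?_
  ext
  simp

theorem hasDerivAt_ofReal_u {a b : ℂ} (ha : a ≠ 0) (hb : b ≠ 0) (y : ℝ) :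
    HasDerivAt (fun s => (u a b s : ℂ)) (du a b y) y :=
  (differentiable_u ha hb y).hasDerivAt.ofReal_comp

theorem frameU_eq {a b : ℂ} (ha : a ≠ 0) (hb : b ≠ 0) (z l : ℂ) :
    frameU (fun z => u a b z.im) (psi a b) z l =
      l⁻¹ • frameU1 a b z.im + frameDiag a b z.im := by
  have h : dz (fun w => (u a b w.im : ℂ)) z = -I * du a b z.im / 2 := by
    rw [dz, (hasFDerivAt_comp_im (hasDerivAt_ofReal_u ha hb z.im)).fderiv]
    simp
  rw [frameU, h, frameU1, frameDiag]
  congr 1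
  ext i j
  fin_cases i <;> fin_cases j <;> simp <;> ring

theorem frameV_eq {a b : ℂ} (ha : a ≠ 0) (hb : b ≠ 0) (z l : ℂ) :
    frameV (fun z => u a b z.im) (psi a b) z l =
      l • frameV1 a b z.im + frameDiag a b z.im := by
  have h : dzbar (fun w => (u a b w.im : ℂ)) z = I * du a b z.im / 2 := by
    rw [dzbar, (hasFDerivAt_comp_im (hasDerivAt_ofReal_u ha hb z.im)).fderiv]
    simp
  rw [frameV, h, frameV1, frameDiag]
  congr 1
  ext i j
  fin_cases i <;> fin_cases j <;> simp <;> ring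

/-! ### Derivatives and continuity -/

theorem eu_ne_zero (a b : ℂ) (y : ℝ) : eu a b y ≠ 0 := ofReal_ne_zero.2 (Real.exp_pos _).ne'

theorem hasDerivAt_eu {a b : ℂ} (ha : a ≠ 0) (hb : b ≠ 0) (y : ℝ) :
    HasDerivAt (eu a b) (eu a b y * du a b y) y := by
  have h := (differentiable_u ha hb y).hasDerivAt.exp.ofReal_comp
  rwa [ofReal_mul] at h

theorem aSq_eq (a : ℂ) : aSq a = a * conj a := by
  rw [aSq, mul_conj, normSq_eq_norm_sq]

theorem norm_sq_eq (a : ℂ) : (‖a‖ : ℂ) ^ 2 = a * conj a := by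
  rw [mul_conj, normSq_eq_norm_sq]
  push_cast
  rfl

theorem hasDerivAt_du {a b : ℂ} (ha : a ≠ 0) (hb : b ≠ 0) (y : ℝ) :
    HasDerivAt (du a b)
      (4 * ((a * conj a) ^ 2 * (b * conj b) / eu a b y ^ 2 - eu a b y)) y := by
  have h := (hasDerivAt_deriv_u ha hb y).ofReal_comp
  refine h.congr_deriv ?_
  rw [_root_.zpow_neg, zpow_ofNat, ← norm_sq_eq, ← norm_sq_eq, eu]
  push_cast
  rw [div_eq_mul_inv]
  ring

theorem du_sq {a b : ℂ} (ha : a ≠ 0) (hb : b ≠ 0) (y : ℝ) :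
    eu a b y ^ 2 * du a b y ^ 2 = -8 * eu a b y ^ 3
      + 4 * (2 * (a * conj a) + b * conj b) * eu a b y ^ 2
      - 4 * ((a * conj a) ^ 2 * (b * conj b)) := by
  have h := congrArg (fun x : ℝ => (x : ℂ)) (deriv_u_sq ha hb y)
  rw [← norm_sq_eq, ← norm_sq_eq, eu, du]
  push_cast at h ⊢
  rw [h]
  ring

theorem hasDerivAt_exp_half {a b : ℂ} (ha : a ≠ 0) (hb : b ≠ 0) (y : ℝ) :
    HasDerivAt (fun s => (Real.exp (u a b s / 2) : ℂ))
      (Real.exp (u a b y / 2) * (du a b y / 2)) y := by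
  have h := ((differentiable_u ha hb y).hasDerivAt.div_const 2).exp.ofReal_comp
  rwa [ofReal_mul, ofReal_div] at h

theorem hasDerivAt_exp_neg {a b : ℂ} (ha : a ≠ 0) (hb : b ≠ 0) (y : ℝ) :
    HasDerivAt (fun s => (Real.exp (-u a b s) : ℂ))
      (Real.exp (-u a b y) * -du a b y) y := by
  have h := (differentiable_u ha hb y).hasDerivAt.neg.exp.ofReal_comp
  rwa [ofReal_mul, ofReal_neg] at h

theorem hasDerivAt_exp_neg_half {a b : ℂ} (ha : a ≠ 0) (hb : b ≠ 0) (y : ℝ) :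
    HasDerivAt (fun s => (Real.exp (-u a b s / 2) : ℂ))
      (Real.exp (-u a b y / 2) * (-du a b y / 2)) y := by
  have h := ((differentiable_u ha hb y).hasDerivAt.neg.div_const 2).exp.ofReal_comp
  rwa [ofReal_mul, ofReal_div, ofReal_neg] at h

theorem exp_half_mul_self (a b : ℂ) (y : ℝ) :
    (Real.exp (u a b y / 2) : ℂ) * Real.exp (u a b y / 2) = eu a b y := by
  rw [← ofReal_mul, ← Real.exp_add, add_halves, eu]

theorem exp_neg_eq (a b : ℂ) (y : ℝ) : (Real.exp (-u a b y) : ℂ) = (eu a b y)⁻¹ := by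
  rw [Real.exp_neg, ofReal_inv, eu]

theorem exp_neg_half_eq (a b : ℂ) (y : ℝ) :
    (Real.exp (-u a b y / 2) : ℂ) = (Real.exp (u a b y / 2) : ℂ)⁻¹ := by
  rw [neg_div, Real.exp_neg, ofReal_inv]

theorem hasDerivAt_frameU1 {a b : ℂ} (ha : a ≠ 0) (hb : b ≠ 0) (y : ℝ) :
    HasDerivAt (frameU1 a b) (du a b y • !![0, 0, I * Real.exp (u a b y / 2) / 2;
      I * psi a b * Real.exp (-u a b y), 0, 0;
      0, I * Real.exp (u a b y / 2) / 2, 0]) y := by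
  have h1 := (hasDerivAt_exp_half ha hb y).const_mul I
  have h2 := (hasDerivAt_exp_neg ha hb y).const_mul (-I * psi a b)
  refine hasDerivAt_matrix_iff.2 fun i j => ?_
  fin_cases i <;> fin_cases j <;>
    simp only [frameU1, Fin.zero_eta, Fin.mk_one, Fin.reduceFinMk, Matrix.of_apply,
      Matrix.cons_val, Matrix.smul_apply, smul_eq_mul, mul_zero]
  all_goals first
    | exact hasDerivAt_const _ _
    | exact h1.congr_deriv (by ring)
    | exact h2.congr_deriv (by ring)

theorem hasDerivAt_frameV1 {a b : ℂ} (ha : a ≠ 0) (hb : b ≠ 0) (y : ℝ) :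
    HasDerivAt (frameV1 a b) (du a b y • !![0, I * conj (psi a b) * Real.exp (-u a b y), 0;
      0, 0, I * Real.exp (u a b y / 2) / 2;
      I * Real.exp (u a b y / 2) / 2, 0, 0]) y := by
  have h1 := (hasDerivAt_exp_half ha hb y).const_mul I
  have h2 := (hasDerivAt_exp_neg ha hb y).const_mul (-I * conj (psi a b))
  refine hasDerivAt_matrix_iff.2 fun i j => ?_
  fin_cases i <;> fin_cases j <;>
    simp only [frameV1, Fin.zero_eta, Fin.mk_one, Fin.reduceFinMk, Matrix.of_apply,
      Matrix.cons_val, Matrix.smul_apply, smul_eq_mul, mul_zero]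
  all_goals first
    | exact hasDerivAt_const _ _
    | exact h1.congr_deriv (by ring)
    | exact h2.congr_deriv (by ring)

theorem hasDerivAt_frameDiag {a b : ℂ} (ha : a ≠ 0) (hb : b ≠ 0) (y : ℝ) :
    HasDerivAt (frameDiag a b)
      ((I * ((a * conj a) ^ 2 * (b * conj b) / eu a b y ^ 2 - eu a b y)) •
        !![-1, 0, 0; 0, 1, 0; 0, 0, 0]) y := by
  have h1 := ((hasDerivAt_du ha hb y).const_mul (-I)).div_const 4
  have h2 := ((hasDerivAt_du ha hb y).const_mul I).div_const 4
  refine hasDerivAt_matrix_iff.2 fun i j => ?_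
  fin_cases i <;> fin_cases j <;>
    simp only [frameDiag, Fin.zero_eta, Fin.mk_one, Fin.reduceFinMk, Matrix.of_apply,
      Matrix.cons_val, Matrix.smul_apply, smul_eq_mul, mul_zero]
  all_goals first
    | exact hasDerivAt_const _ _
    | exact h1.congr_deriv (by ring)
    | exact h2.congr_deriv (by ring)

theorem continuous_of_hasDerivAt {X X' : ℝ → Mat3} (h : ∀ y, HasDerivAt X (X' y) y) :
    Continuous X := continuous_matrix_iff.2 fun i j => continuous_iff_continuousAt.2 fun y =>
  (hasDerivAt_matrix_iff.1 (h y) i j).continuousAt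

theorem continuous_frameU1 {a b : ℂ} (ha : a ≠ 0) (hb : b ≠ 0) : Continuous (frameU1 a b) :=
  continuous_of_hasDerivAt (hasDerivAt_frameU1 ha hb)

theorem continuous_frameV1 {a b : ℂ} (ha : a ≠ 0) (hb : b ≠ 0) : Continuous (frameV1 a b) :=
  continuous_of_hasDerivAt (hasDerivAt_frameV1 ha hb)

theorem continuous_frameDiag {a b : ℂ} (ha : a ≠ 0) (hb : b ≠ 0) : Continuous (frameDiag a b) :=
  continuous_of_hasDerivAt (hasDerivAt_frameDiag ha hb)

theorem hasDerivAt_of_eq {X : ℝ → Mat3} {X' X'' : Mat3} {t : ℝ} (h : HasDerivAt X X' t)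
    (e : X' = X'') : HasDerivAt X X'' t := e ▸ h

theorem hasDerivAt_add {X Y : ℝ → Mat3} {X' Y' : Mat3} {t : ℝ} (hX : HasDerivAt X X' t)
    (hY : HasDerivAt Y Y' t) : HasDerivAt (fun s => X s + Y s) (X' + Y') t := by
  rw [hasDerivAt_matrix_iff] at *
  exact fun i j => (hX i j).add (hY i j)

theorem hasDerivAt_smul {X : ℝ → Mat3} {X' : Mat3} {f : ℝ → ℂ} {f' : ℂ} {t : ℝ}
    (hf : HasDerivAt f f' t) (hX : HasDerivAt X X' t) :
    HasDerivAt (fun s => f s • X s) (f t • X' + f' • X t) t := by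
  rw [hasDerivAt_matrix_iff] at *
  exact fun i j => (hf.mul (hX i j)).congr_deriv (add_comm _ _)

theorem hasDerivAt_const_smul {X : ℝ → Mat3} {X' : Mat3} {t : ℝ} (c : ℂ)
    (hX : HasDerivAt X X' t) : HasDerivAt (fun s => c • X s) (c • X') t := by
  simpa using hasDerivAt_smul (hasDerivAt_const t c) hX

/-- The integrability condition for functions of `y` only. -/
theorem hasDerivAt_frameX {a b l : ℂ} (ha : a ≠ 0) (hb : b ≠ 0) (hl : l ≠ 0) (y : ℝ) :
    HasDerivAt (frameX a b l)
      (frameX a b l y * frameY a b l y - frameY a b l y * frameX a b l y) y := by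
  refine hasDerivAt_of_eq (hasDerivAt_add (hasDerivAt_add
    (hasDerivAt_const_smul l⁻¹ (hasDerivAt_frameU1 ha hb y))
    (hasDerivAt_const_smul l (hasDerivAt_frameV1 ha hb y)))
    (hasDerivAt_const_smul 2 (hasDerivAt_frameDiag ha hb y))) ?_
  have hw := eu_ne_zero a b y
  have hE := exp_half_mul_self a b y
  ext i j
  simp only [frameX, frameY, frameU1, frameV1, frameDiag, exp_neg_eq, Matrix.sub_apply,
    Matrix.smul_apply, Matrix.add_apply, smul_eq_mul, Matrix.mul_apply, Fin.sum_univ_three, psi,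
    map_mul, map_neg, map_pow, conj_I]
  generalize (Real.exp (u a b y / 2) : ℂ) = E at *
  generalize eu a b y = w at *
  generalize du a b y = v at *
  generalize conj a = A
  generalize conj b = B
  -- With w = E² all exponentials are powers of the single variable E, and the Lax equation becomes
  -- a rational identity.
  subst hE
  have hE : E ≠ 0 := left_ne_zero_of_mul hw
  have I5 : I ^ 5 = I := by rw [pow_succ, I_pow_four, one_mul]
  fin_cases i <;> fin_cases j <;>
    simp only [Fin.zero_eta, Fin.mk_one, Fin.reduceFinMk, Matrix.of_apply, Matrix.cons_val] <;>
    field_simp <;> ring_nf <;> simp only [I_sq, I_pow_three, I_pow_four, I5] <;> ring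

end MinLag
end

noncomputable section

namespace MinLag

open Complex ComplexConjugate Matrix

/-! ### Symmetries of the coefficient matrices -/

theorem eps_pow_three : eps ^ 3 = -1 := by
  rw [eps, ← Complex.exp_nat_mul, ← Complex.exp_pi_mul_I]
  congr 1
  push_cast
  ring

theorem eps_inv : eps⁻¹ = -eps ^ 2 := by
  refine inv_eq_of_mul_eq_one_right ?_
  linear_combination -eps_pow_three

theorem twistP_eq : twistP = !![0, eps ^ 2, 0; -eps, 0, 0; 0, 0, 1] := by
  have h : exp (2 * Real.pi * I / 3) = eps ^ 2 := by
    rw [eps, ← Complex.exp_nat_mul]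
    congr 1
    push_cast
    ring
  rw [twistP, h, show (eps ^ 2) ^ 2 = -eps by linear_combination eps * eps_pow_three]

/-- U₋₁, the diagonal part and V₁ are eigenvectors of the differential of σ with eigenvalues ε⁻¹, 1
and ε. This matches the effect of λ ↦ ελ on their coefficients λ⁻¹, 1, λ. -/
theorem frameU1_mul_twistP (a b : ℂ) (y : ℝ) :
    eps⁻¹ • (frameU1 a b y * twistP) = -(twistP * (frameU1 a b y)ᵀ) := by
  rw [eps_inv, twistP_eq, frameU1]
  have h3 := eps_pow_three
  ext i j
  simp only [Matrix.mul_apply, Fin.sum_univ_three, Matrix.transpose_apply, Matrix.neg_apply,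
    Matrix.smul_apply, smul_eq_mul]
  fin_cases i <;> fin_cases j <;>
    simp only [Fin.zero_eta, Fin.mk_one, Fin.reduceFinMk, Matrix.of_apply, Matrix.cons_val] <;>
    grind

theorem frameV1_mul_twistP (a b : ℂ) (y : ℝ) :
    eps • (frameV1 a b y * twistP) = -(twistP * (frameV1 a b y)ᵀ) := by
  rw [twistP_eq, frameV1]
  have h3 := eps_pow_three
  ext i j
  simp only [Matrix.mul_apply, Fin.sum_univ_three, Matrix.transpose_apply, Matrix.neg_apply,
    Matrix.smul_apply, smul_eq_mul]
  fin_cases i <;> fin_cases j <;>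
    simp only [Fin.zero_eta, Fin.mk_one, Fin.reduceFinMk, Matrix.of_apply, Matrix.cons_val] <;>
    grind

theorem frameDiag_mul_twistP (a b : ℂ) (y : ℝ) :
    frameDiag a b y * twistP = -(twistP * (frameDiag a b y)ᵀ) := by
  rw [twistP_eq, frameDiag]
  ext i j
  simp only [Matrix.mul_apply, Fin.sum_univ_three, Matrix.transpose_apply, Matrix.neg_apply]
  fin_cases i <;> fin_cases j <;>
    simp only [Fin.zero_eta, Fin.mk_one, Fin.reduceFinMk, Matrix.of_apply, Matrix.cons_val] <;>
    ring

theorem frameY_twist (a b l : ℂ) (y : ℝ) :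
    frameY a b (eps * l) y * twistP = -(twistP * (frameY a b l y)ᵀ) := by
  have h1 := frameU1_mul_twistP a b y
  have h2 := frameV1_mul_twistP a b y
  simp only [frameY, add_mul, transpose_add, transpose_smul, mul_add, Matrix.smul_mul,
    Matrix.mul_smul, mul_inv, neg_add, ← smul_neg, ← h1, ← h2, smul_smul]
  congr 2 <;> ring

theorem framePlus_twist (a b l : ℂ) (y : ℝ) :
    framePlus a b (eps * l) y * twistP = -(twistP * (framePlus a b l y)ᵀ) := by
  have h1 := frameDiag_mul_twistP a b y
  have h2 := frameV1_mul_twistP a b y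
  simp only [framePlus, add_mul, transpose_add, transpose_smul, mul_add, Matrix.smul_mul,
    Matrix.mul_smul, neg_add, ← smul_neg, ← h1, ← h2, smul_smul]
  congr 2 ; ring

theorem potential_twist (a b l : ℂ) :
    potential a b (eps * l) * twistP = -(twistP * (potential a b l)ᵀ) := by
  have h3 := eps_pow_three
  rw [twistP_eq, potential, potential, mul_inv, eps_inv]
  ext i j
  simp only [Matrix.mul_apply, Fin.sum_univ_three, Matrix.transpose_apply, Matrix.neg_apply]
  fin_cases i <;> fin_cases j <;>
    simp only [Fin.zero_eta, Fin.mk_one, Fin.reduceFinMk, Matrix.of_apply, Matrix.cons_val] <;>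
    grind

theorem frameU1_conjTranspose (a b : ℂ) (y : ℝ) : (frameU1 a b y)ᴴ = -frameV1 a b y := by
  rw [frameU1, frameV1]
  ext i j
  fin_cases i <;> fin_cases j <;> simp [← Complex.exp_conj, conj_ofNat]

theorem frameY_conjTranspose {a b l : ℂ} (hl : ‖l‖ = 1) (y : ℝ) :
    (frameY a b l y)ᴴ = -frameY a b l y := by
  have h1 := frameU1_conjTranspose a b y
  have h2 : (frameV1 a b y)ᴴ = -frameU1 a b y := by
    rw [← neg_eq_iff_eq_neg.2 h1, conjTranspose_neg, conjTranspose_conjTranspose]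
  simp only [frameY, conjTranspose_add, conjTranspose_smul, h1, h2, Complex.inv_eq_conj hl]
  simp only [star_def, map_mul, map_neg, conj_I, conj_conj]
  module

theorem potential_conjTranspose {a b l : ℂ} (hl : ‖l‖ = 1) :
    (potential a b l)ᴴ = -potential a b l := by
  rw [potential, Complex.inv_eq_conj hl]
  ext i j
  fin_cases i <;> fin_cases j <;> simp

theorem trace_frameY (a b l : ℂ) (y : ℝ) : (frameY a b l y).trace = 0 := by
  simp [frameY, frameU1, frameV1, Matrix.trace_fin_three]

theorem trace_framePlus (a b l : ℂ) (y : ℝ) : (framePlus a b l y).trace = 0 := by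
  simp [framePlus, frameDiag, frameV1, Matrix.trace_fin_three]
  ring

theorem trace_potential (a b l : ℂ) : (potential a b l).trace = 0 := by
  simp [potential, Matrix.trace_fin_three]

/-! ### The initial value -/

theorem exp_u_half_zero {a b : ℂ} (ha : a ≠ 0) (hb : b ≠ 0) :
    Real.exp (u a b 0 / 2) = ‖a‖ := by
  rw [Real.exp_half, exp_u_zero ha hb, Real.sqrt_sq (norm_nonneg a)]

theorem Q0_zero {a b : ℂ} (ha : a ≠ 0) (hb : b ≠ 0) :
    Q0 a b 0 = !![I * a⁻¹ * ‖a‖, 0, 0; 0, -I * a * (‖a‖ : ℂ)⁻¹, 0; 0, 0, 1] := by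
  rw [Q0, exp_neg_half_eq, exp_u_half_zero ha hb]

/-- The inverse of `Q₀(0)`. -/
def Q0Inv (a : ℂ) : Mat3 :=
  !![-I * a * (‖a‖ : ℂ)⁻¹, 0, 0; 0, I * a⁻¹ * ‖a‖, 0; 0, 0, 1]

theorem Q0Inv_mul_Q0 {a b : ℂ} (ha : a ≠ 0) (hb : b ≠ 0) : Q0Inv a * Q0 a b 0 = 1 := by
  have h : (‖a‖ : ℂ) ≠ 0 := by simpa using ha
  rw [Q0_zero ha hb, Q0Inv]
  ext i j
  fin_cases i <;> fin_cases j <;> simp [Matrix.mul_apply, Fin.sum_univ_three] <;> field_simp <;>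
    simp

theorem Q0_mul_Q0Inv {a b : ℂ} (ha : a ≠ 0) (hb : b ≠ 0) : Q0 a b 0 * Q0Inv a = 1 :=
  mul_eq_one_comm.1 (Q0Inv_mul_Q0 ha hb)

theorem det_Q0Inv {a : ℂ} (ha : a ≠ 0) : (Q0Inv a).det = 1 := by
  have h : (‖a‖ : ℂ) ≠ 0 := by simpa using ha
  rw [Q0Inv, det_fin_three]
  simp
  field_simp
  simp

theorem Q0Inv_mem {a : ℂ} (ha : a ≠ 0) : Q0Inv a ∈ specialUnitaryGroup (Fin 3) ℂ := by
  have h : (‖a‖ : ℂ) ≠ 0 := by simpa using ha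
  have ha' : conj a ≠ 0 := by simpa using ha
  have h2 := norm_sq_eq a
  refine mem_specialUnitaryGroup_iff.2 ⟨mem_unitaryGroup_iff.2 ?_, det_Q0Inv ha⟩
  rw [star_eq_conjTranspose, Q0Inv]
  ext i j
  fin_cases i <;> fin_cases j <;> simp [Matrix.mul_apply, Fin.sum_univ_three] <;> field_simp <;>
    simp [h2]

theorem sigma_Q0Inv {a : ℂ} (ha : a ≠ 0) : sigma (Q0Inv a) = Q0Inv a := by
  have h : (‖a‖ : ℂ) ≠ 0 := by simpa using ha
  have h3 := eps_pow_three
  refine sigma_eq_of_mul_eq_one ?_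
  rw [twistP_eq, Q0Inv]
  ext i j
  simp only [Matrix.mul_apply, Fin.sum_univ_three, Matrix.transpose_apply]
  fin_cases i <;> fin_cases j <;>
    simp only [Fin.zero_eta, Fin.mk_one, Fin.reduceFinMk, Matrix.of_apply, Matrix.cons_val] <;>
    simp <;> field_simp <;> simp <;> linear_combination -h3

/-- At y = 0 one has u' = 0 and eᵘ = |a|², so conjugation by the unitary diagonal matrix Q₀(0) turns
D into X(0). This is what dictates the initial value of the frame. -/
theorem potential_mul_Q0Inv {a b l : ℂ} (ha : a ≠ 0) (hb : b ≠ 0) :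
    potential a b l * Q0Inv a = Q0Inv a * frameX a b l 0 := by
  have h : (‖a‖ : ℂ) ≠ 0 := by simpa using ha
  have h2 := norm_sq_eq a
  have hdu : du a b 0 = 0 := by rw [du, deriv_u_zero ha hb, ofReal_zero]
  have heu : eu a b 0 = (‖a‖ : ℂ) ^ 2 := by rw [eu, exp_u_zero ha hb, ofReal_pow]
  rw [frameX, frameU1, frameV1, frameDiag, hdu, exp_u_half_zero ha hb, exp_neg_eq, heu, potential,
    Q0Inv]
  ext i j
  fin_cases i <;> fin_cases j <;>
    simp [Matrix.mul_apply, Fin.sum_univ_three, psi] <;> field_simp <;>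
    simp [h2, show (‖a‖ : ℂ) ^ 4 = (‖a‖ ^ 2) ^ 2 by ring] <;> ring

end MinLag
end

noncomputable section

namespace MinLag

open Complex ComplexConjugate Matrix Metric

/-! ### Uniqueness of the Iwasawa splitting -/

theorem diffContOnCl_mul {f g : ℂ → ℂ} {s : Set ℂ} (hf : DiffContOnCl ℂ f s)
    (hg : DiffContOnCl ℂ g s) : DiffContOnCl ℂ (fun l => f l * g l) s := hf.smul hg

/-- A function that is holomorphic in the unit disc and real on its boundary is constant. -/
theorem eq_of_real_on_sphere {f : ℂ → ℂ} (hf : DiffContOnCl ℂ f (ball 0 1))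
    (him : ∀ l ∈ sphere (0 : ℂ) 1, (f l).im = 0) :
    ∀ l ∈ sphere (0 : ℂ) 1, f l = f 0 := by
  have hfr : frontier (ball (0 : ℂ) 1) = sphere 0 1 := frontier_ball 0 one_ne_zero
  have hcl : closure (ball (0 : ℂ) 1) = closedBall 0 1 := closure_ball 0 one_ne_zero
  have hexp : ∀ g : ℂ → ℂ, DiffContOnCl ℂ g (ball 0 1) →
      DiffContOnCl ℂ (fun l => exp (g l)) (ball 0 1) := fun g hg =>
    ⟨hg.1.cexp, hg.2.cexp⟩
  -- Maximum principle for exp g, whose modulus is exp(Re g).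
  have hbound : ∀ g : ℂ → ℂ, DiffContOnCl ℂ g (ball 0 1) →
      (∀ l ∈ sphere (0 : ℂ) 1, (g l).re ≤ 0) → ∀ l ∈ closedBall (0 : ℂ) 1, (g l).re ≤ 0 := by
    intro g hg hre l hl
    have h := norm_le_of_forall_mem_frontier_norm_le isBounded_ball (hexp g hg) (C := 1)
      (fun w hw => by
        rw [norm_exp, Real.exp_le_one_iff]
        exact hre w (hfr ▸ hw)) (hcl ▸ hl)
    rwa [norm_exp, Real.exp_le_one_iff] at h
  -- Both if and -if have real part 0 on the circle, so the bound applies with either sign.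
  have h0 : (f 0).im = 0 := by
    have h1 := hbound (fun l => I * f l) (diffContOnCl_mul diffContOnCl_const hf)
      (fun l hl => by simp [him l hl]) 0 (by simp)
    have h2 := hbound (fun l => -I * f l) (diffContOnCl_mul diffContOnCl_const hf)
      (fun l hl => by simp [him l hl]) 0 (by simp)
    simp only [neg_mul, neg_re, I_mul_re] at h1 h2
    linarith
  -- As f - f(0) is real on the circle, exp(-(f - f(0))²) has modulus at most 1 there and equals 1
  -- at the centre. The strong maximum principle makes it constant.
  have hg : DiffContOnCl ℂ (fun l => -((f l - f 0) * (f l - f 0))) (ball 0 1) :=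
    (diffContOnCl_mul (hf.sub_const _) (hf.sub_const _)).neg
  have hre : ∀ l ∈ sphere (0 : ℂ) 1,
      -((f l - f 0) * (f l - f 0)) = ((-((f l).re - (f 0).re) ^ 2 : ℝ) : ℂ) := by
    intro l hl
    apply Complex.ext
    · rw [ofReal_re]
      simp [him l hl, h0]
      ring
    · rw [ofReal_im]
      simp [him l hl, h0]
  have hmax : IsMaxOn (norm ∘ fun l => exp (-((f l - f 0) * (f l - f 0)))) (ball 0 1) 0 := by
    intro l hl
    have := hbound _ hg (fun w hw => by rw [hre w hw, ofReal_re]; nlinarith) l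
      (ball_subset_closedBall hl)
    simpa [norm_exp] using this
  intro l hl
  have h := Complex.eqOn_closedBall_of_isMaxOn_norm (hexp _ hg) hmax (sphere_subset_closedBall hl)
  simp only [Function.const_apply, hre l hl, sub_self, mul_zero, neg_zero, exp_zero] at h
  rw [← ofReal_exp, ofReal_eq_one, Real.exp_eq_one_iff, neg_eq_zero, sq_eq_zero_iff,
    sub_eq_zero] at h
  exact Complex.ext h (by rw [him l hl, h0])

/-- Both f + g and i(f - g) are real on the circle. -/
theorem eq_of_conj_eq_on_sphere {f g : ℂ → ℂ} (hf : DiffContOnCl ℂ f (ball 0 1))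
    (hg : DiffContOnCl ℂ g (ball 0 1)) (hfg : ∀ l ∈ sphere (0 : ℂ) 1, conj (f l) = g l) :
    ∀ l ∈ sphere (0 : ℂ) 1, f l = f 0 ∧ g l = g 0 := by
  intro l hl
  have h1 := eq_of_real_on_sphere (hf.add hg) (fun l hl => by simp [← hfg l hl]) l hl
  have h2 := eq_of_real_on_sphere (diffContOnCl_mul (diffContOnCl_const (c := I)) (hf.sub hg))
    (fun l hl => by simp [← hfg l hl]) l hl
  simp only [Pi.add_apply, Pi.sub_apply] at h1 h2
  have h3 := mul_left_cancel₀ I_ne_zero h2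
  constructor
  · linear_combination (h1 + h3) / 2
  · linear_combination (h1 - h3) / 2

/-- For loops of determinant 1 the adjugate is the inverse, and it is polynomial in the entries. -/
theorem diffContOnCl_adjugate {v : ℂ → Mat3} {s : Set ℂ}
    (h : ∀ i j, DiffContOnCl ℂ (fun l => v l i j) s) (i j : Fin 3) :
    DiffContOnCl ℂ (fun l => (v l).adjugate i j) s := by
  simp only [adjugate_fin_three]
  fin_cases i <;> fin_cases j <;>
    simp only [Fin.zero_eta, Fin.mk_one, Fin.reduceFinMk, Matrix.of_apply, Matrix.cons_val]
  all_goals first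
    | exact (diffContOnCl_mul (h _ _) (h _ _)).sub (diffContOnCl_mul (h _ _) (h _ _))
    | exact (diffContOnCl_mul (h _ _) (h _ _)).neg.add (diffContOnCl_mul (h _ _) (h _ _))

theorem diffContOnCl_matrix_mul {v w : ℂ → Mat3} {s : Set ℂ}
    (hv : ∀ i j, DiffContOnCl ℂ (fun l => v l i j) s)
    (hw : ∀ i j, DiffContOnCl ℂ (fun l => w l i j) s) (i j : Fin 3) :
    DiffContOnCl ℂ (fun l => (v l * w l) i j) s := by
  simp only [Matrix.mul_apply, Fin.sum_univ_three]
  exact ((diffContOnCl_mul (hv _ _) (hw _ _)).add (diffContOnCl_mul (hv _ _) (hw _ _))).add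
    (diffContOnCl_mul (hv _ _) (hw _ _))

theorem eps_ne_neg_one : eps ≠ -1 := by
  intro h
  have h1 := congrArg Complex.re h
  rw [eps, show (Real.pi * I / 3 : ℂ) = ((Real.pi / 3 : ℝ) : ℂ) * I by push_cast; ring,
    exp_ofReal_mul_I_re, Real.cos_pi_div_three] at h1
  norm_num at h1

/-- The fixed points of `σ` are diagonal. -/
theorem apply_eq_zero_of_sigma_eq {g : Mat3} (hdet : g.det = 1) (h : sigma g = g) {i j : Fin 3}
    (hij : i ≠ j) : g i j = 0 := by
  have hu : IsUnit gᵀ.det := by rw [det_transpose, hdet]; exact isUnit_one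
  have h1 : g * twistP * gᵀ = twistP := by
    rw [sigma, twistP_inv] at h
    calc g * twistP * gᵀ = twistP * gᵀ⁻¹ * twistP * twistP * gᵀ := by rw [h]
      _ = twistP := by
        rw [mul_assoc _ twistP twistP, twistP_mul_self, mul_one, mul_assoc, nonsing_inv_mul _ hu,
          mul_one]
  have h2 : g * (twistPᵀ * gᵀ) = twistPᵀ := by
    conv_rhs => rw [← h1]
    simp only [transpose_mul, transpose_transpose]
  have h3 : gᵀ * (twistP * g * twistP) = 1 := by
    rw [mul_eq_one_comm, mul_assoc, mul_assoc, ← mul_assoc g, h1, twistP_mul_self]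
  -- Applying σ twice shows that g commutes with PᵗP, a diagonal matrix with the three cube roots of
  -- unity as its distinct entries.
  have h4 : g * (twistPᵀ * twistP) = twistPᵀ * twistP * g := by
    calc g * (twistPᵀ * twistP) = g * (twistPᵀ * (gᵀ * (twistP * g * twistP)) * twistP) := by
          rw [h3, mul_one]
      _ = g * (twistPᵀ * gᵀ) * (twistP * g * (twistP * twistP)) := by simp only [mul_assoc]
      _ = _ := by rw [h2, twistP_mul_self, mul_one, mul_assoc]
  have e3 := eps_pow_three
  have e1 := eps_ne_neg_one
  have h5 : twistPᵀ * twistP = Matrix.diagonal ![eps ^ 2, -eps, 1] := by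
    rw [twistP_eq]
    ext i j
    simp only [Matrix.mul_apply, Fin.sum_univ_three, Matrix.transpose_apply]
    fin_cases i <;> fin_cases j <;> simp [Matrix.diagonal] <;> grind
  rw [h5] at h4
  have h6 := congrFun (congrFun h4 i) j
  rw [mul_diagonal, diagonal_mul] at h6
  have e0 : eps ≠ 1 := fun h => by rw [h] at e3; norm_num at e3
  have hne : (![eps ^ 2, -eps, 1] : Fin 3 → ℂ) i ≠ (![eps ^ 2, -eps, 1] : Fin 3 → ℂ) j := by
    fin_cases i <;> fin_cases j <;> simp at hij ⊢ <;> grind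
  have h7 : ((![eps ^ 2, -eps, 1] : Fin 3 → ℂ) j - (![eps ^ 2, -eps, 1] : Fin 3 → ℂ) i) * g i j
      = 0 := by linear_combination h6
  exact (mul_eq_zero.1 h7).resolve_left (sub_ne_zero.2 hne.symm)

/-- On the circle v'v⁻¹ = h'*h is unitary, so its adjoint is vv'⁻¹. Both quotients extend
holomorphically to the disc, hence are constant, and comparison at λ = 0 shows that the constant is
1. -/
theorem IsIwasawaSplitting.unitary_unique {g h v h' v' : ℂ → Mat3}
    (H : IsIwasawaSplitting g h v) (H' : IsIwasawaSplitting g h' v') {l : ℂ}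
    (hl : l ∈ sphere (0 : ℂ) 1) : h l = h' l := by
  have hdet : ∀ {v : ℂ → Mat3}, IsPlusLoop v → ∀ w ∈ closedBall (0 : ℂ) 1,
      (v w).adjugate * v w = 1 := fun hv w hw => by
    rw [adjugate_mul, hv.det_eq w hw, one_smul]
  have hdet' : ∀ {v : ℂ → Mat3}, IsPlusLoop v → ∀ w ∈ closedBall (0 : ℂ) 1,
      v w * (v w).adjugate = 1 := fun hv w hw => by
    rw [mul_adjugate, hv.det_eq w hw, one_smul]
  have hun : ∀ {h : ℂ → Mat3}, IsUnitaryLoop h → ∀ w ∈ sphere (0 : ℂ) 1,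
      (h w)ᴴ * h w = 1 := fun hh w hw =>
    mem_unitaryGroup_iff'.1 (mem_specialUnitaryGroup_iff.1 (hh.mem w hw)).1
  have h0 : (0 : ℂ) ∈ closedBall (0 : ℂ) 1 := by simp
  let Φ : ℂ → Mat3 := fun w => v' w * (v w).adjugate
  let Ψ : ℂ → Mat3 := fun w => v w * (v' w).adjugate
  have hΦ := diffContOnCl_matrix_mul H'.plus.holomorphic (diffContOnCl_adjugate H.plus.holomorphic)
  have hΨ := diffContOnCl_matrix_mul H.plus.holomorphic (diffContOnCl_adjugate H'.plus.holomorphic)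
  have hquot : ∀ {h v h' v' : ℂ → Mat3}, IsIwasawaSplitting g h v → IsIwasawaSplitting g h' v' →
      ∀ w ∈ sphere (0 : ℂ) 1, (h' w)ᴴ * h w = v' w * (v w).adjugate := by
    intro h v h' v' H H' w hw
    have e := (H.eq_mul w hw).symm.trans (H'.eq_mul w hw)
    calc (h' w)ᴴ * h w = (h' w)ᴴ * (h w * v w) * (v w).adjugate := by
          rw [mul_assoc, mul_assoc, hdet' H.plus w (sphere_subset_closedBall hw), mul_one]
      _ = (h' w)ᴴ * h' w * (v' w * (v w).adjugate) := by rw [e]; simp only [mul_assoc]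
      _ = _ := by rw [hun H'.unitary w hw, one_mul]
  have hconj : ∀ w ∈ sphere (0 : ℂ) 1, ∀ i j, conj (Φ w i j) = Ψ w j i := by
    intro w hw i j
    have e := congrArg conjTranspose (hquot H H' w hw)
    rw [conjTranspose_mul, conjTranspose_conjTranspose, hquot H' H w hw] at e
    exact (congrFun (congrFun e j) i).symm
  have hconst : ∀ w ∈ sphere (0 : ℂ) 1, ∀ i j, Φ w i j = Φ 0 i j ∧ Ψ w j i = Ψ 0 j i :=
    fun w hw i j => eq_of_conj_eq_on_sphere (hΦ i j) (hΨ j i) (fun w hw => hconj w hw i j) w hw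
  have hconj0 : ∀ i j, conj (Φ 0 i j) = Ψ 0 j i := fun i j => by
    rw [← (hconst l hl i j).1, ← (hconst l hl i j).2, hconj l hl]
  -- At λ = 0 the twisting condition says that v(0) is a fixed point of σ.
  have hdiag : ∀ {v : ℂ → Mat3}, IsPlusLoop v → ∀ {i j}, i ≠ j → v 0 i j = 0 := fun hv i j hij =>
    apply_eq_zero_of_sigma_eq (hv.det_eq 0 h0) (by simpa using hv.twisted 0 h0) hij
  have e1 : Φ 0 * v 0 = v' 0 := by rw [mul_assoc, hdet H.plus 0 h0, mul_one]
  have e2 : Ψ 0 * v' 0 = v 0 := by rw [mul_assoc, hdet H'.plus 0 h0, mul_one]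
  have hmul : ∀ {v : ℂ → Mat3}, IsPlusLoop v → ∀ (M : Mat3) i, (M * v 0) i i = M i i * v 0 i i :=
    fun hv M i => by
      rw [Matrix.mul_apply, Finset.sum_eq_single i (fun k _ hk => by rw [hdiag hv hk, mul_zero])
        (by simp)]
  have hreal : ∀ {v : ℂ → Mat3} {h : ℂ → Mat3}, IsIwasawaSplitting g h v → ∀ i,
      ((v 0 i i).re : ℂ) = v 0 i i := fun H i =>
    Complex.ext (ofReal_re _) (by rw [ofReal_im, (H.pos_diag i).1])
  have hv : v' 0 = v 0 := by
    ext i j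
    rcases eq_or_ne i j with rfl | hij
    · have f1 := congrFun (congrFun e1 i) i
      have f2 := congrFun (congrFun e2 i) i
      rw [hmul H.plus] at f1
      rw [hmul H'.plus, ← hconj0] at f2
      have p1 := (H.pos_diag i).2
      have p2 := (H'.pos_diag i).2
      rw [← hreal H i] at f1 f2 ⊢
      rw [← hreal H' i] at f1 f2 ⊢
      -- On the diagonal, v'(0) = Φ(0)v(0) and v(0) = conj Φ(0) · v'(0). Hence the squares agree,
      -- and positivity decides the sign.
      have f3 : (((v' 0 i i).re ^ 2 : ℝ) : ℂ) = (((v 0 i i).re ^ 2 : ℝ) : ℂ) := by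
        have f4 := congrArg conj f1
        rw [map_mul, conj_ofReal, conj_ofReal] at f4
        push_cast
        linear_combination -(((v' 0 i i).re : ℂ)) * f4 + ((v 0 i i).re : ℂ) * f2
      rw [ofReal_inj] at f3 ⊢
      nlinarith
    · rw [hdiag H.plus hij, hdiag H'.plus hij]
  have hΦ1 : Φ l = 1 := by
    have : Φ l = Φ 0 := by
      ext i j
      exact (hconst l hl i j).1
    rw [this, show Φ 0 = v 0 * (v 0).adjugate by rw [← hv]; simp only [Φ, hv],
      hdet' H.plus 0 h0]
  have e := hquot H H' l hl
  rw [show v' l * (v l).adjugate = 1 from hΦ1] at e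
  have hl2 : h' l * (h' l)ᴴ = 1 := mul_eq_one_comm.1 (hun H'.unitary l hl)
  rw [← one_mul (h l), ← hl2, mul_assoc, e, mul_one]

end MinLag
end

noncomputable section

attribute [local instance] Matrix.linftyOpNormedRing Matrix.linftyOpNormedAlgebra

namespace MinLag

open Complex ComplexConjugate Matrix Metric LinearODE

/-! ### The matrix exponential -/

theorem hasDerivAt_exp_smul {f : ℝ → ℂ} {f' : ℂ} {t : ℝ} (hf : HasDerivAt f f' t) (M : Mat3) :
    HasDerivAt (fun s => NormedSpace.exp (f s • M)) (f' • (M * NormedSpace.exp (f t • M))) t := by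
  have h : HasDerivAt (fun z : ℂ => NormedSpace.exp (z • M)) _ (f t) :=
    hasDerivAt_exp_smul_const' M (f t)
  exact HasDerivAt.scomp t h hf

theorem exp_smul_commute (c : ℂ) (M : Mat3) : M * NormedSpace.exp (c • M) =
    NormedSpace.exp (c • M) * M :=
  ((Commute.refl M).smul_right c).exp_right

theorem exp_add_smul (c d : ℂ) (M : Mat3) : NormedSpace.exp ((c + d) • M) =
    NormedSpace.exp (c • M) * NormedSpace.exp (d • M) := by
  rw [add_smul]
  exact Matrix.exp_add_of_commute _ _ (((Commute.refl M).smul_right d).smul_left c)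

theorem isSol_exp (M : Mat3) :
    IsSol (fun _ => M) fun s : ℝ => NormedSpace.exp ((s : ℂ) • M) := fun y => by
  refine hasDerivAt_of_eq (hasDerivAt_exp_smul ofRealCLM.hasDerivAt M (t := y)) ?_
  rw [ofRealCLM_apply, ofReal_one, one_smul, exp_smul_commute]
  rfl

theorem exp_zero_smul (M : Mat3) : NormedSpace.exp ((0 : ℂ) • M) = 1 := by
  rw [zero_smul, NormedSpace.exp_zero]

theorem differentiableOn_matrix_mul {v w : ℂ → Mat3} {s : Set ℂ}
    (hv : ∀ i j, DifferentiableOn ℂ (fun l => v l i j) s)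
    (hw : ∀ i j, DifferentiableOn ℂ (fun l => w l i j) s) (i j : Fin 3) :
    DifferentiableOn ℂ (fun l => (v l * w l) i j) s := by
  simp only [Matrix.mul_apply]
  exact DifferentiableOn.fun_sum fun k _ => (hv i k).mul (hw k j)

theorem differentiableOn_exp {M : ℂ → Mat3} {s : Set ℂ}
    (hM : ∀ i j, DifferentiableOn ℂ (fun l => M l i j) s) (i j : Fin 3) :
    DifferentiableOn ℂ (fun l => NormedSpace.exp (M l) i j) s := by
  have h : DifferentiableOn ℂ M s := differentiableOn_matrix_iff.2 hM
  refine (differentiableOn_matrix_iff (X := fun l => NormedSpace.exp (M l))).1 ?_ i j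
  intro l hl
  exact (NormedSpace.exp_analytic (𝕂 := ℂ) (M l)).differentiableAt.comp_differentiableWithinAt l
    (h l hl)

/-! ### The extended frame -/

theorem frameY_eq_separated (a b l : ℂ) : frameY a b l =
    separated ![fun l => I * l⁻¹, fun l => -I * l] ![frameU1 a b, frameV1 a b] l := by
  ext1 y
  simp [frameY, separated]

theorem framePlus_eq_separated (a b l : ℂ) : framePlus a b l =
    separated ![fun l => -2 * I * l, fun _ => -2 * I] ![frameV1 a b, frameDiag a b] l := by
  ext1 y
  simp [framePlus, separated]

theorem continuous_frameY {a b : ℂ} (ha : a ≠ 0) (hb : b ≠ 0) (l : ℂ) :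
    Continuous (frameY a b l) := by
  rw [frameY_eq_separated]
  refine continuous_separated (fun i => ?_) l
  fin_cases i
  · exact continuous_frameU1 ha hb
  · exact continuous_frameV1 ha hb

theorem continuous_framePlus {a b : ℂ} (ha : a ≠ 0) (hb : b ≠ 0) (l : ℂ) :
    Continuous (framePlus a b l) := by
  rw [framePlus_eq_separated]
  refine continuous_separated (fun i => ?_) l
  fin_cases i
  · exact continuous_frameV1 ha hb
  · exact continuous_frameDiag ha hb

theorem differentiableOn_sol_frameY {a b : ℂ} (ha : a ≠ 0) (hb : b ≠ 0) (y : ℝ) (i j : Fin 3) :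
    DifferentiableOn ℂ (fun l => sol (frameY a b l) y i j) {0}ᶜ := by
  refine (differentiableOn_matrix_iff (X := fun l => sol (frameY a b l) y)).1 ?_ i j
  simp only [frameY_eq_separated]
  refine differentiableOn_sol isOpen_compl_singleton (fun i => ?_) (fun i => ?_) y
  · fin_cases i
    · exact (differentiableOn_inv.const_mul I)
    · exact (differentiableOn_id.const_mul (-I))
  · fin_cases i
    · exact continuous_frameU1 ha hb
    · exact continuous_frameV1 ha hb

theorem differentiable_solInv_framePlus {a b : ℂ} (ha : a ≠ 0) (hb : b ≠ 0) (y : ℝ)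
    (i j : Fin 3) : Differentiable ℂ (fun l => solInv (framePlus a b l) y i j) := by
  rw [← differentiableOn_univ]
  refine (differentiableOn_matrix_iff (X := fun l => solInv (framePlus a b l) y)).1 ?_ i j
  simp only [framePlus_eq_separated]
  refine differentiableOn_solInv isOpen_univ (fun i => ?_) (fun i => ?_) y
  · fin_cases i
    · exact (differentiableOn_id.const_mul (-2 * I))
    · exact differentiableOn_const _
  · fin_cases i
    · exact continuous_frameV1 ha hb
    · exact continuous_frameDiag ha hb

/-- The extended frame along the imaginary axis. -/
def frameSol (a b l : ℂ) (y : ℝ) : Mat3 := Q0Inv a * sol (frameY a b l) y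

/-- The extended frame `𝔽(z, λ)`. -/
def extFrame (a b z l : ℂ) : Mat3 :=
  NormedSpace.exp ((z.re : ℂ) • potential a b l) * frameSol a b l z.im

theorem isSol_frameSol {a b : ℂ} (ha : a ≠ 0) (hb : b ≠ 0) (l : ℂ) :
    IsSol (frameY a b l) (frameSol a b l) := (isSol_sol (continuous_frameY ha hb l)).const_mul _

theorem frameSol_zero (a b l : ℂ) : frameSol a b l 0 = Q0Inv a := by
  rw [frameSol, sol_zero, mul_one]

/-- By the Lax equation X' = [X, Y] the conjugate S X S⁻¹ of X by a solution S is constant in y. It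
remains to evaluate it at y = 0. -/
theorem potential_mul_frameSol {a b l : ℂ} (ha : a ≠ 0) (hb : b ≠ 0) (hl : l ≠ 0) (y : ℝ) :
    potential a b l * frameSol a b l y = frameSol a b l y * frameX a b l y := by
  have hc := continuous_frameY ha hb l
  have key : sol (frameY a b l) y * (frameX a b l y * solInv (frameY a b l) y) =
      frameX a b l 0 := by
    have h := eq_of_hasDerivAt_zero (X := fun s => sol (frameY a b l) s *
      (frameX a b l s * solInv (frameY a b l) s)) (fun s => ?_) y
    · simpa [sol_zero, solInv_zero] using h
    · refine hasDerivAt_of_eq (hasDerivAt_mul (isSol_sol hc s)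
        (hasDerivAt_mul (hasDerivAt_frameX ha hb hl s) (hasDerivAt_solInv hc s))) ?_
      noncomm_ring
  have key2 : sol (frameY a b l) y * frameX a b l y = frameX a b l 0 * sol (frameY a b l) y := by
    rw [← key, mul_assoc, mul_assoc, solInv_mul_sol hc, mul_one]
  rw [frameSol, ← mul_assoc, potential_mul_Q0Inv ha hb, mul_assoc, ← key2, mul_assoc]

theorem det_frameSol {a b : ℂ} (ha : a ≠ 0) (hb : b ≠ 0) (l : ℂ) (y : ℝ) :
    (frameSol a b l y).det = 1 := by
  rw [(isSol_frameSol ha hb l).det_eq (trace_frameY a b l) y, frameSol_zero, det_Q0Inv ha]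

theorem det_exp_potential (a b l : ℂ) (x : ℝ) :
    (NormedSpace.exp ((x : ℂ) • potential a b l)).det = 1 := by
  rw [(isSol_exp (potential a b l)).det_eq (fun _ => trace_potential a b l) x, ofReal_zero,
    exp_zero_smul, det_one]

theorem det_extFrame {a b : ℂ} (ha : a ≠ 0) (hb : b ≠ 0) (z l : ℂ) : (extFrame a b z l).det = 1 := by
  rw [extFrame, det_mul, det_exp_potential, det_frameSol ha hb, one_mul]

theorem differentiableOn_potential (a b : ℂ) (i j : Fin 3) :
    DifferentiableOn ℂ (fun l => potential a b l i j) {0}ᶜ := by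
  have h1 : DifferentiableOn ℂ (fun l : ℂ => l⁻¹) {0}ᶜ := differentiableOn_inv
  fin_cases i <;> fin_cases j <;>
    simp only [potential, Fin.zero_eta, Fin.mk_one, Fin.reduceFinMk, Matrix.of_apply,
      Matrix.cons_val] <;> fun_prop

theorem differentiableOn_extFrame {a b : ℂ} (ha : a ≠ 0) (hb : b ≠ 0) (z : ℂ) (i j : Fin 3) :
    DifferentiableOn ℂ (fun l => extFrame a b z l i j) {0}ᶜ := by
  refine differentiableOn_matrix_mul (v := fun l => NormedSpace.exp ((z.re : ℂ) • potential a b l))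
    (w := fun l => frameSol a b l z.im) (differentiableOn_exp fun i j => ?_) (fun i j => ?_) i j
  · exact (differentiableOn_potential a b i j).const_mul _
  · exact differentiableOn_matrix_mul (v := fun _ => Q0Inv a)
      (w := fun l => sol (frameY a b l) z.im) (fun _ _ => differentiableOn_const _)
      (differentiableOn_sol_frameY ha hb z.im) i j

theorem ne_zero_of_mem_sphere {l : ℂ} (hl : l ∈ sphere (0 : ℂ) 1) : l ≠ 0 := by
  rintro rfl
  simp at hl

theorem sigma_one : sigma 1 = 1 := by
  rw [sigma, transpose_one, inv_one, mul_one, twistP_inv, twistP_mul_self]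

theorem sigma_sol_frameY {a b : ℂ} (ha : a ≠ 0) (hb : b ≠ 0) (l : ℂ) (y : ℝ) :
    sigma (sol (frameY a b l) y) = sol (frameY a b (eps * l)) y :=
  (isSol_sol (continuous_frameY ha hb l)).sigma_eq (isSol_sol (continuous_frameY ha hb (eps * l)))
    (frameY_twist a b l) (sol_zero _) (sol_zero _) y

theorem sigma_exp_potential (a b l : ℂ) (x : ℝ) :
    sigma (NormedSpace.exp ((x : ℂ) • potential a b l)) =
      NormedSpace.exp ((x : ℂ) • potential a b (eps * l)) :=
  (isSol_exp (potential a b l)).sigma_eq (isSol_exp (potential a b (eps * l)))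
    (fun _ => potential_twist a b l) (by simp) (by simp) x

theorem isUnitaryLoop_extFrame {a b : ℂ} (ha : a ≠ 0) (hb : b ≠ 0) (z : ℂ) :
    IsUnitaryLoop (extFrame a b z) where
  continuousOn i j := (differentiableOn_extFrame ha hb z i j).continuousOn.mono fun _ hl =>
    ne_zero_of_mem_sphere hl
  mem l hl := by
    have hl' : ‖l‖ = 1 := by simpa using hl
    refine mul_mem ?_ ?_
    · refine (isSol_exp (potential a b l)).mem_specialUnitaryGroup
        (fun _ => potential_conjTranspose hl') (fun _ => trace_potential a b l) ?_ z.re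
      simp [one_mem]
    · refine (isSol_frameSol ha hb l).mem_specialUnitaryGroup (frameY_conjTranspose hl')
        (trace_frameY a b l) ?_ z.im
      rw [frameSol_zero]
      exact Q0Inv_mem ha
  twisted l _ := by
    rw [extFrame, frameSol, sigma_mul, sigma_mul, sigma_exp_potential, sigma_Q0Inv ha,
      sigma_sol_frameY ha hb, extFrame, frameSol]

theorem hasFDerivAt_extFrame {a b : ℂ} (ha : a ≠ 0) (hb : b ≠ 0) {l : ℂ} (hl : l ≠ 0) (z : ℂ)
    (i j : Fin 3) : HasFDerivAt (fun z => extFrame a b z l i j)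
      (reCLM.smulRight ((extFrame a b z l * frameX a b l z.im) i j) +
        imCLM.smulRight ((extFrame a b z l * frameY a b l z.im) i j)) z := by
  have h1 := fun k => hasFDerivAt_comp_re (z := z)
    (hasDerivAt_matrix_iff.1 (isSol_exp (potential a b l) z.re) i k)
  have h2 := fun k => hasFDerivAt_comp_im (z := z)
    (hasDerivAt_matrix_iff.1 (isSol_frameSol ha hb l z.im) k j)
  have h3 := HasFDerivAt.fun_sum (u := Finset.univ) fun k _ => (h1 k).mul (h2 k)
  refine h3.congr_fderiv ?_
  -- Differentiation in x produces D between the exponential and S; the relation DS = SX moves it to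
  -- the right as X.
  have e1 : extFrame a b z l * frameX a b l z.im = NormedSpace.exp ((z.re : ℂ) • potential a b l) *
      potential a b l * frameSol a b l z.im := by
    rw [extFrame, mul_assoc, ← potential_mul_frameSol ha hb hl, mul_assoc]
  have e2 : extFrame a b z l * frameY a b l z.im = NormedSpace.exp ((z.re : ℂ) • potential a b l) *
      (frameSol a b l z.im * frameY a b l z.im) := by rw [extFrame, mul_assoc]
  rw [e1, e2]
  ext
  simp [Matrix.mul_apply, Fin.sum_univ_three]
  ring

theorem isExtendedFrame_extFrame {a b : ℂ} (ha : a ≠ 0) (hb : b ≠ 0) :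
    IsExtendedFrame (fun z => u a b z.im) (psi a b) (extFrame a b) where
  holomorphic := differentiableOn_extFrame ha hb
  unitary := isUnitaryLoop_extFrame ha hb
  det_eq z l _ := det_extFrame ha hb z l
  differentiable l hl i j z := (hasFDerivAt_extFrame ha hb hl z i j).differentiableAt
  eq_dz l hl z := by
    have hu : IsUnit (extFrame a b z l).det := by rw [det_extFrame ha hb]; exact isUnit_one
    have h : (Matrix.of fun i j => dz (fun w => extFrame a b w l i j) z) =
        extFrame a b z l * frameU (fun z => u a b z.im) (psi a b) z l := by
      have e : frameU (fun z => u a b z.im) (psi a b) z l =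
          (1 / 2 : ℂ) • (frameX a b l z.im - I • frameY a b l z.im) := by
        rw [frameU_eq ha hb]
        simp only [frameX, frameY, smul_sub, smul_add, smul_smul]
        simp only [← mul_assoc, mul_neg, neg_mul, I_mul_I]
        module
      ext i j
      rw [e, Matrix.mul_smul, Matrix.mul_sub, Matrix.mul_smul]
      simp only [Matrix.of_apply, dz, (hasFDerivAt_extFrame ha hb hl z i j).fderiv]
      simp
      ring
    rw [h, nonsing_inv_mul_cancel_left _ _ hu]
  eq_dzbar l hl z := by
    have hu : IsUnit (extFrame a b z l).det := by rw [det_extFrame ha hb]; exact isUnit_one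
    have h : (Matrix.of fun i j => dzbar (fun w => extFrame a b w l i j) z) =
        extFrame a b z l * frameV (fun z => u a b z.im) (psi a b) z l := by
      have e : frameV (fun z => u a b z.im) (psi a b) z l =
          (1 / 2 : ℂ) • (frameX a b l z.im + I • frameY a b l z.im) := by
        rw [frameV_eq ha hb]
        simp only [frameX, frameY, smul_add, smul_smul]
        simp only [← mul_assoc, mul_neg, neg_mul, I_mul_I]
        module
      ext i j
      rw [e, Matrix.mul_smul, Matrix.mul_add, Matrix.mul_smul]
      simp only [Matrix.of_apply, dzbar, (hasFDerivAt_extFrame ha hb hl z i j).fderiv]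
      simp
      ring
    rw [h, nonsing_inv_mul_cancel_left _ _ hu]

theorem extFrame_add (a b : ℂ) (t : ℝ) (z l : ℂ) : extFrame a b (t + z) l =
    NormedSpace.exp ((t : ℂ) • potential a b l) * extFrame a b z l := by
  rw [extFrame, extFrame, ← mul_assoc, ← exp_add_smul]
  simp

theorem extFrame_zero_mul_Q0 {a b : ℂ} (ha : a ≠ 0) (hb : b ≠ 0) (l : ℂ) :
    extFrame a b 0 l * Q0 a b 0 = 1 := by
  rw [extFrame, zero_re, ofReal_zero, exp_zero_smul, one_mul, zero_im, frameSol_zero,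
    Q0Inv_mul_Q0 ha hb]

end MinLag
end

noncomputable section

attribute [local instance] Matrix.linftyOpNormedRing Matrix.linftyOpNormedAlgebra

namespace MinLag

open Complex ComplexConjugate Matrix Metric LinearODE

/-! ### The plus factor -/

/-- The plus factor `V₊(y, λ)` of the Iwasawa splitting. -/
def plusFactor (a b : ℂ) (y : ℝ) (l : ℂ) : Mat3 :=
  Q0Inv a * solInv (framePlus a b l) y * Q0 a b 0

theorem det_Q0_zero {a b : ℂ} (ha : a ≠ 0) (hb : b ≠ 0) : (Q0 a b 0).det = 1 := by
  have h := congrArg det (Q0Inv_mul_Q0 (b := b) ha hb)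
  rwa [det_mul, det_Q0Inv ha, det_one, one_mul] at h

theorem sigma_eq_of_mul {g h g' h' : Mat3} (H : g * h = 1) (H' : h' * g' = 1)
    (hg : sigma g = g') : sigma h = h' := by
  have e : g' * sigma h = 1 := by rw [← hg, ← sigma_mul, H, sigma_one]
  rw [← one_mul (sigma h), ← H', mul_assoc, e, mul_one]

theorem sigma_Q0_zero {a b : ℂ} (ha : a ≠ 0) (hb : b ≠ 0) : sigma (Q0 a b 0) = Q0 a b 0 :=
  sigma_eq_of_mul (Q0Inv_mul_Q0 ha hb) (Q0_mul_Q0Inv ha hb) (sigma_Q0Inv ha)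

theorem plusFactor_twisted {a b : ℂ} (ha : a ≠ 0) (hb : b ≠ 0) (y : ℝ) (l : ℂ) :
    sigma (plusFactor a b y l) = plusFactor a b y (eps * l) := by
  have hc := continuous_framePlus ha hb
  have h : sigma (sol (framePlus a b l) y) = sol (framePlus a b (eps * l)) y :=
    (isSol_sol (hc l)).sigma_eq (isSol_sol (hc (eps * l)))
      (framePlus_twist a b l) (sol_zero _) (sol_zero _) y
  rw [plusFactor, sigma_mul, sigma_mul, sigma_Q0Inv ha, sigma_Q0_zero ha hb,
    sigma_eq_of_mul (sol_mul_solInv (hc l) y) (solInv_mul_sol (hc _) y) h, plusFactor]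

theorem det_plusFactor {a b : ℂ} (ha : a ≠ 0) (hb : b ≠ 0) (y : ℝ) (l : ℂ) :
    (plusFactor a b y l).det = 1 := by
  have hc := continuous_framePlus ha hb l
  have h := congrArg det (sol_mul_solInv hc y)
  rw [det_mul, (isSol_sol hc).det_eq (trace_framePlus a b l), sol_zero, det_one, one_mul] at h
  rw [plusFactor, det_mul, det_mul, det_Q0Inv ha, det_Q0_zero ha hb, h, one_mul, one_mul]

theorem isPlusLoop_plusFactor {a b : ℂ} (ha : a ≠ 0) (hb : b ≠ 0) (y : ℝ) :
    IsPlusLoop (plusFactor a b y) where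
  holomorphic := diffContOnCl_matrix_mul (v := fun l => Q0Inv a * solInv (framePlus a b l) y)
    (w := fun _ => Q0 a b 0) (diffContOnCl_matrix_mul (v := fun _ => Q0Inv a)
      (w := fun l => solInv (framePlus a b l) y) (fun _ _ => diffContOnCl_const)
      fun i j => (differentiable_solInv_framePlus ha hb y i j).diffContOnCl)
    fun _ _ => diffContOnCl_const
  det_eq l _ := det_plusFactor ha hb y l
  twisted l _ := plusFactor_twisted ha hb y l

/-- At λ = 0 only the diagonal coefficient survives, and the equation is solved by e^{±u/2}. The
constant factor normalizes the value at y = 0, where e^{u/2} = |a|. -/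
theorem solInv_framePlus_zero {a b : ℂ} (ha : a ≠ 0) (hb : b ≠ 0) (y : ℝ) :
    solInv (framePlus a b 0) y = !![(Real.exp (u a b y / 2) : ℂ), 0, 0;
      0, Real.exp (-u a b y / 2), 0; 0, 0, 1] * !![(‖a‖ : ℂ)⁻¹, 0, 0; 0, ‖a‖, 0; 0, 0, 1] := by
  have hn : (‖a‖ : ℂ) ≠ 0 := by simpa using ha
  have hc := continuous_framePlus ha hb 0
  let T : ℝ → Mat3 := fun y => !![(Real.exp (u a b y / 2) : ℂ), 0, 0;
      0, Real.exp (-u a b y / 2), 0; 0, 0, 1]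
  have hT : ∀ s, HasDerivAt T (-framePlus a b 0 s * T s) s := by
    intro s
    refine hasDerivAt_matrix_iff.2 fun i j => ?_
    have hI := I_mul_I
    have h1 := hasDerivAt_exp_half ha hb s
    have h2 := hasDerivAt_exp_neg_half ha hb s
    fin_cases i <;> fin_cases j <;>
      simp only [T, framePlus, frameDiag, frameV1, Fin.zero_eta, Fin.mk_one, Fin.reduceFinMk,
        Matrix.of_apply, Matrix.cons_val, Matrix.mul_apply, Fin.sum_univ_three, Matrix.neg_apply,
        Matrix.add_apply, Matrix.smul_apply, smul_eq_mul, mul_zero, add_zero, zero_mul, neg_zero,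
        zero_add, mul_one]
    all_goals first
      | exact hasDerivAt_const _ _
      | exact h1.congr_deriv
          (by linear_combination 1 / 2 * du a b s * (Real.exp (u a b s / 2) : ℂ) * hI)
      | exact h2.congr_deriv
          (by linear_combination -1 / 2 * du a b s * (Real.exp (-u a b s / 2) : ℂ) * hI)
  have h := (isSol_sol hc).mul_eq hT (fun s => add_neg_cancel _) y
  rw [sol_zero, one_mul] at h
  have h0 : T 0 * !![(‖a‖ : ℂ)⁻¹, 0, 0; 0, ‖a‖, 0; 0, 0, 1] = 1 := by
    simp only [T, exp_neg_half_eq, exp_u_half_zero ha hb, Matrix.mul_fin_three]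
    ext i j
    fin_cases i <;> fin_cases j <;> simp [hn]
  change _ = T y * _
  calc solInv (framePlus a b 0) y
      = solInv (framePlus a b 0) y * (T 0 * !![(‖a‖ : ℂ)⁻¹, 0, 0; 0, ‖a‖, 0; 0, 0, 1]) := by
        rw [h0, mul_one]
    _ = _ := by rw [← h, mul_assoc, ← mul_assoc (solInv _ _), solInv_mul_sol hc, one_mul]

theorem plusFactor_zero {a b : ℂ} (ha : a ≠ 0) (hb : b ≠ 0) (y : ℝ) :
    plusFactor a b y 0 = !![((Real.exp (u a b y / 2) / ‖a‖ : ℝ) : ℂ), 0, 0;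
      0, ((Real.exp (-u a b y / 2) * ‖a‖ : ℝ) : ℂ), 0; 0, 0, 1] := by
  have hn : (‖a‖ : ℂ) ≠ 0 := by simpa using ha
  have hI := I_mul_I
  rw [plusFactor, solInv_framePlus_zero ha hb, Q0_zero ha hb, Q0Inv, Matrix.mul_fin_three,
    Matrix.mul_fin_three, Matrix.mul_fin_three, ofReal_div, ofReal_mul]
  ext i j
  fin_cases i <;> fin_cases j <;>
    simp only [Fin.zero_eta, Fin.mk_one, Fin.reduceFinMk, Matrix.of_apply, Matrix.cons_val,
      mul_zero, zero_mul, add_zero, zero_add, mul_one]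
  · field_simp
    linear_combination -hI
  · field_simp
    linear_combination -hI

/-- Since DS = SX, the derivative of exp(-iyD) S is exp(-iyD) S (Y - iX); both sides solve the same
equation with the same initial value. -/
theorem exp_mul_frameSol {a b l : ℂ} (ha : a ≠ 0) (hb : b ≠ 0) (hl : l ≠ 0) (y : ℝ) :
    NormedSpace.exp ((-I * y) • potential a b l) * frameSol a b l y =
      Q0Inv a * sol (framePlus a b l) y := by
  have hc := continuous_framePlus ha hb l
  have hd : ∀ s : ℝ, HasDerivAt (fun s : ℝ => -I * (s : ℂ)) (-I) s := fun s => by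
    simpa using ofRealCLM.hasDerivAt (x := s) |>.const_mul (-I)
  have h1 : IsSol (framePlus a b l)
      fun s => NormedSpace.exp ((-I * (s : ℂ)) • potential a b l) * frameSol a b l s := by
    intro s
    refine hasDerivAt_of_eq (hasDerivAt_mul (hasDerivAt_exp_smul (hd s) _)
      (isSol_frameSol ha hb l s)) ?_
    rw [exp_smul_commute, ← frameY_sub_frameX, mul_sub, Matrix.mul_smul, mul_assoc (NormedSpace.exp _)
      (frameSol a b l s) (frameX a b l s), ← potential_mul_frameSol ha hb hl]
    simp only [Matrix.smul_mul, mul_assoc]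
    module
  have h2 := h1.mul_eq (hasDerivAt_solInv hc) (fun s => add_neg_cancel _) y
  simp only [ofReal_zero, mul_zero, exp_zero_smul, one_mul, frameSol_zero, solInv_zero,
    mul_one] at h2
  rw [← h2, mul_assoc _ (solInv _ _), solInv_mul_sol hc, mul_one]

theorem isIwasawaSplitting {a b : ℂ} (ha : a ≠ 0) (hb : b ≠ 0) (z : ℂ) :
    IsIwasawaSplitting (fun l => NormedSpace.exp (z • potential a b l))
      (fun l => extFrame a b z l * Q0 a b 0) (plusFactor a b z.im) where
  unitary :=
    have h := isUnitaryLoop_extFrame ha hb z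
    { continuousOn := fun i j => by
        simp only [Matrix.mul_apply]
        exact continuousOn_finsetSum _ fun k _ => (h.continuousOn i k).mul continuousOn_const
      mem := fun l hl => by
        refine mul_mem (h.mem l hl) ?_
        have hu := (mem_specialUnitaryGroup_iff.1 (Q0Inv_mem ha)).1
        have e : Q0 a b 0 = star (Q0Inv a) := by
          rw [← one_mul (Q0 a b 0), ← mem_unitaryGroup_iff'.1 hu, mul_assoc, Q0Inv_mul_Q0 ha hb,
            mul_one]
        exact mem_specialUnitaryGroup_iff.2 ⟨e ▸ Unitary.star_mem hu, det_Q0_zero ha hb⟩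
      twisted := fun l hl => by rw [sigma_mul, sigma_Q0_zero ha hb, h.twisted l hl] }
  plus := isPlusLoop_plusFactor ha hb z.im
  pos_diag i := by
    have h1 := Real.exp_pos (u a b z.im / 2)
    have h2 := Real.exp_pos (-u a b z.im / 2)
    have h3 := norm_pos_iff.2 ha
    rw [plusFactor_zero ha hb]
    fin_cases i <;>
      simp only [Fin.zero_eta, Fin.mk_one, Fin.reduceFinMk, Matrix.of_apply, Matrix.cons_val,
        ofReal_im, ofReal_re, one_im, one_re, true_and]
    · positivity
    · positivity
    · exact one_pos
  eq_mul l hl := by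
    have hl0 := ne_zero_of_mem_sphere hl
    have hc := continuous_framePlus ha hb l
    have h := exp_mul_frameSol ha hb hl0 z.im
    have h' : frameSol a b l z.im = NormedSpace.exp ((I * z.im) • potential a b l) *
        (Q0Inv a * sol (framePlus a b l) z.im) := by
      rw [← h, ← mul_assoc, ← exp_add_smul, show I * (z.im : ℂ) + -I * z.im = 0 by ring,
        exp_zero_smul, one_mul]
    calc NormedSpace.exp (z • potential a b l)
        = NormedSpace.exp ((z.re : ℂ) • potential a b l) *
            NormedSpace.exp ((I * z.im) • potential a b l) := by
          rw [← exp_add_smul, mul_comm I, re_add_im]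
      -- Insert Q₀(0)Q₀(0)⁻¹ between the solution and its inverse: this separates the unitary factor
      -- from the plus factor.
      _ = NormedSpace.exp ((z.re : ℂ) • potential a b l) *
            (NormedSpace.exp ((I * z.im) • potential a b l) *
            (Q0Inv a * (sol (framePlus a b l) z.im * ((Q0 a b 0 * Q0Inv a) *
              solInv (framePlus a b l) z.im)) * Q0 a b 0)) := by
          rw [Q0_mul_Q0Inv ha hb, one_mul, sol_mul_solInv hc, mul_one, Q0Inv_mul_Q0 ha hb, mul_one]
      _ = extFrame a b z l * Q0 a b 0 * plusFactor a b z.im l := by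
          rw [extFrame, h', plusFactor]
          simp only [mul_assoc]

theorem isGeneratedBy_extFrame {a b : ℂ} (ha : a ≠ 0) (hb : b ≠ 0) :
    IsGeneratedBy (potential a b) fun z l => extFrame a b z l * Q0 a b 0 := fun z =>
  ⟨plusFactor a b z.im, isIwasawaSplitting ha hb z⟩

theorem eq_extFrame_of_isGeneratedBy {a b : ℂ} (ha : a ≠ 0) (hb : b ≠ 0) {F : ℂ → ℂ → Mat3}
    (hF : IsGeneratedBy (potential a b) F) (z : ℂ) {l : ℂ} (hl : ‖l‖ = 1) :
    F z l = extFrame a b z l * Q0 a b 0 := by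
  obtain ⟨v, hv⟩ := hF z
  exact hv.unitary_unique (isIwasawaSplitting ha hb z) (by simpa using hl)

end MinLag
end

noncomputable section

attribute [local instance] Matrix.linftyOpNormedRing Matrix.linftyOpNormedAlgebra

namespace MinLag

open Complex ComplexConjugate Matrix Metric LinearODE

/-! ### Where `č` does not vanish -/

theorem eu_mul_du {a b : ℂ} (ha : a ≠ 0) (hb : b ≠ 0) (y : ℝ) :
    eu a b y * du a b y = (conformalDeriv a b y : ℂ) := by
  rw [eu, du, ← ofReal_mul, exp_mul_deriv_u ha hb]

/-- On the circle λ³ψ̄ - λ⁻³ψ is a number minus its conjugate, hence purely imaginary, while eᵘu' is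
real. So č can vanish only if λ³ψ̄ is real. -/
theorem cCheck_ne_zero_of_norm_eq_one {a b : ℂ} (ha : a ≠ 0) (hb : b ≠ 0) {l : ℂ} (hl : ‖l‖ = 1)
    (h : l ^ 6 * conj (psi a b) ≠ psi a b) (y : ℝ) : cCheck a b y l ≠ 0 := by
  have hl0 : l ≠ 0 := by rintro rfl; simp at hl
  intro h0
  rw [cCheck, eu_mul_du ha hb, ← inv_pow, Complex.inv_eq_conj hl] at h0
  have h1 := congrArg Complex.im h0
  have h2 : conj l ^ 3 * psi a b = conj (l ^ 3 * conj (psi a b)) := by simp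
  rw [h2, sub_im, sub_im, conj_im, ofReal_im, zero_im] at h1
  have h3 : conj (l ^ 3 * conj (psi a b)) = l ^ 3 * conj (psi a b) := conj_eq_iff_im.2 (by linarith)
  rw [← h2, ← Complex.inv_eq_conj hl] at h3
  apply h
  calc l ^ 6 * conj (psi a b) = l ^ 3 * (l ^ 3 * conj (psi a b)) := by ring
    _ = psi a b := by
      rw [← h3]
      field_simp

/-- The first-order equation gives w'² ≤ 4βw², and t ≤ t² + 1 avoids a square root. Any bound
uniform in y suffices. -/
theorem abs_conformalDeriv_le {a b : ℂ} (ha : a ≠ 0) (hb : b ≠ 0) (y : ℝ) :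
    |conformalDeriv a b y| ≤ 4 * betaConst a b * (a1 a + a2 a b) ^ 2 + 1 := by
  have h := conformalDeriv_sq ha hb y
  have h0 := conformalFactor_pos ha hb y
  have h1 := conformalFactor_le ha hb y
  have hβ : 0 ≤ betaConst a b := by
    rw [betaConst_eq ha]
    have := a1_pos ha
    positivity
  have h2 : conformalFactor a b y ^ 2 ≤ (a1 a + a2 a b) ^ 2 := by gcongr
  have h3 : 0 ≤ 8 * conformalFactor a b y ^ 3 + 4 * ‖psi a b‖ ^ 2 := by positivity
  nlinarith [sq_nonneg (|conformalDeriv a b y| - 1), sq_abs (conformalDeriv a b y)]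

theorem exists_cCheck_ne_zero {a b : ℂ} (ha : a ≠ 0) (hb : b ≠ 0) :
    ∃ ε > 0, ∀ l : ℂ, l ≠ 0 → ‖l‖ < ε → ∀ y, cCheck a b y l ≠ 0 := by
  set M := 4 * betaConst a b * (a1 a + a2 a b) ^ 2 + 1
  have hM : 0 ≤ M := (abs_nonneg _).trans (abs_conformalDeriv_le ha hb 0)
  have hψ : 0 < ‖psi a b‖ := by
    rw [norm_psi]
    have := norm_pos_iff.2 ha
    have := norm_pos_iff.2 hb
    positivity
  -- The radius is at most 1. If č = 0, then ψ = λ(λ⁵ψ̄ - λ²eᵘu'), whence |ψ| ≤ |λ|(|ψ| + M), which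
  -- the radius excludes.
  refine ⟨‖psi a b‖ / (‖psi a b‖ + M + 1), by positivity, fun l hl0 hl y h0 => ?_⟩
  rw [cCheck, eu_mul_du ha hb] at h0
  have h1 : psi a b = l * (l ^ 5 * conj (psi a b) - l ^ 2 * conformalDeriv a b y) := by
    have : l ^ 3 * (l ^ 3 * conj (psi a b) - (l ^ 3)⁻¹ * psi a b - conformalDeriv a b y) = 0 := by
      rw [h0, mul_zero]
    rw [mul_sub, mul_sub, mul_inv_cancel_left₀ (pow_ne_zero 3 hl0)] at this
    linear_combination -this
  have hl1 : ‖l‖ ≤ 1 := hl.le.trans (by rw [div_le_one (by positivity)]; linarith)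
  have h2 : ‖psi a b‖ ≤ ‖l‖ * (‖psi a b‖ + M) := by
    conv_lhs => rw [h1]
    rw [norm_mul]
    refine mul_le_mul_of_nonneg_left ((norm_sub_le _ _).trans (add_le_add ?_ ?_)) (norm_nonneg _)
    · rw [norm_mul, norm_pow, RCLike.norm_conj]
      exact mul_le_of_le_one_left (norm_nonneg _) (pow_le_one₀ (norm_nonneg _) hl1)
    · rw [norm_mul, norm_pow, norm_real, Real.norm_eq_abs]
      exact (mul_le_of_le_one_left (abs_nonneg _) (pow_le_one₀ (norm_nonneg _) hl1)).trans
        (abs_conformalDeriv_le ha hb y)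
  rw [lt_div_iff₀ (by positivity)] at hl
  nlinarith [norm_nonneg l]

/-! ### The matrix `Q` -/

theorem gaugePoly_eq (a b l : ℂ) (y : ℝ) :
    gaugePoly a (conj a) b (conj b) l (eu a b y) (du a b y) =
      !![pCheck a b y l, qCheck a b y l, v1Check a b y l;
         sCheck a b y l, tCheck a b y l, v2Check a b y l;
         0, 0, cCheck a b y l] := by
  simp only [gaugePoly, pCheck, qCheck, sCheck, tCheck, v1Check, v2Check, cCheck, aSq_eq, psi,
    map_mul, map_neg, map_pow, conj_I, neg_neg]

theorem gaugePoly_two_two (a b l : ℂ) (y : ℝ) :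
    gaugePoly a (conj a) b (conj b) l (eu a b y) (du a b y) 2 2 = cCheck a b y l := by
  rw [gaugePoly_eq]
  rfl

/-- The derivative of the matrix of the functions `p̌, q̌, …, č`. -/
def gaugeDeriv (a b l : ℂ) (y : ℝ) : Mat3 :=
  gaugePolyDeriv a (conj a) b (conj b) l (eu a b y) (du a b y)
    (4 * ((a * conj a) ^ 2 * (b * conj b) / eu a b y ^ 2 - eu a b y))

theorem hasDerivAt_gaugePoly {a b : ℂ} (ha : a ≠ 0) (hb : b ≠ 0) (l : ℂ) (y : ℝ) :
    HasDerivAt (fun s => gaugePoly a (conj a) b (conj b) l (eu a b s) (du a b s))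
      (gaugeDeriv a b l y) y := by
  have hw := hasDerivAt_eu ha hb y
  have hv := hasDerivAt_du ha hb y
  have hw0 := eu_ne_zero a b y
  have hi : HasDerivAt (fun s => (eu a b s)⁻¹) (-(du a b y / eu a b y)) y :=
    (hw.inv hw0).congr_deriv (by field_simp)
  rw [hasDerivAt_matrix_iff]
  simp only [gaugeDeriv, gaugePoly, gaugePolyDeriv]
  generalize 4 * ((a * conj a) ^ 2 * (b * conj b) / eu a b y ^ 2 - eu a b y) = v₁ at *
  intro i j
  fin_cases i <;> fin_cases j <;>
    simp only [Fin.zero_eta, Fin.mk_one, Fin.reduceFinMk, Matrix.of_apply, Matrix.cons_val]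
  · exact ((((hv.div_const 2).const_mul (-(a * conj a))).add
      (hi.const_mul (l ^ 3 * (I * conj a ^ 2 * conj b) * (a * conj a)))).sub_const _).congr_deriv
      (by ring)
  · exact ((((hv.div_const 2).mul_const (a * conj a)).sub
      ((hi.const_mul (l ^ 3 * (I * conj a ^ 2 * conj b))).mul
        (hw.const_sub (a * conj a)))).const_mul ((l ^ 2)⁻¹ * a / conj a)).congr_deriv
      (by field_simp; ring)
  · exact ((hw.const_sub (a * conj a)).const_mul (-2 * I * l⁻¹ * a)).congr_deriv (by ring)
  · exact (((((hv.div_const 2).const_mul (a * conj a)).mul hw).add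
      ((hw.const_sub (a * conj a)).const_mul ((l ^ 3)⁻¹ * (-I * a ^ 2 * b)))).const_mul
        (l ^ 2 / a ^ 2)).congr_deriv (by ring)
  · exact ((((((hv.div_const 2).const_mul (-(a * conj a))).mul hw).add
      (hw.const_mul (l ^ 3 * (I * conj a ^ 2 * conj b)))).sub_const
        ((l ^ 3)⁻¹ * (-I * a ^ 2 * b) * (a * conj a))).const_mul (1 / (a * conj a))).congr_deriv
      (by ring)
  · exact ((hw.const_mul (-2 * I * l * a⁻¹)).mul (hw.const_sub (a * conj a))).congr_deriv (by ring)
  · exact hasDerivAt_const _ _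
  · exact hasDerivAt_const _ _
  · exact ((hw.mul hv).const_sub _).congr_deriv (by ring)

theorem hasDerivAt_cCheck {a b : ℂ} (ha : a ≠ 0) (hb : b ≠ 0) (l : ℂ) (y : ℝ) :
    HasDerivAt (fun s => cCheck a b s l) (gaugeDeriv a b l y 2 2) y := by
  simpa only [gaugePoly_two_two] using hasDerivAt_matrix_iff.1 (hasDerivAt_gaugePoly ha hb l y) 2 2

theorem continuous_eu {a b : ℂ} (ha : a ≠ 0) (hb : b ≠ 0) : Continuous (eu a b) :=
  continuous_iff_continuousAt.2 fun y => (hasDerivAt_eu ha hb y).continuousAt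

theorem continuous_du {a b : ℂ} (ha : a ≠ 0) (hb : b ≠ 0) : Continuous (du a b) :=
  continuous_iff_continuousAt.2 fun y => (hasDerivAt_du ha hb y).continuousAt

theorem continuous_cCheck {a b : ℂ} (ha : a ≠ 0) (hb : b ≠ 0) (l : ℂ) :
    Continuous fun s => cCheck a b s l :=
  continuous_iff_continuousAt.2 fun y => (hasDerivAt_cCheck ha hb l y).continuousAt

theorem continuous_gaugeDeriv {a b : ℂ} (ha : a ≠ 0) (hb : b ≠ 0) (l : ℂ) :
    Continuous fun s => gaugeDeriv a b l s 2 2 := by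
  have h1 := continuous_eu ha hb
  have h2 := continuous_du ha hb
  simp only [gaugeDeriv, gaugePolyDeriv, Matrix.of_apply, Matrix.cons_val]
  have h3 : Continuous fun s => (a * conj a) ^ 2 * (b * conj b) / eu a b s ^ 2 :=
    continuous_const.div (h1.pow 2) fun s => pow_ne_zero 2 (eu_ne_zero a b s)
  fun_prop

theorem hasDerivAt_Q0 {a b : ℂ} (ha : a ≠ 0) (hb : b ≠ 0) (y : ℝ) :
    HasDerivAt (Q0 a b) (Q0 a b y * !![du a b y / 2, 0, 0; 0, -du a b y / 2, 0; 0, 0, 0]) y := by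
  have h1 := (hasDerivAt_exp_half ha hb y).const_mul (I * a⁻¹)
  have h2 := (hasDerivAt_exp_neg_half ha hb y).const_mul (-I * a)
  refine hasDerivAt_matrix_iff.2 fun i j => ?_
  simp only [Q0, Matrix.mul_fin_three]
  fin_cases i <;> fin_cases j <;>
    simp only [Fin.zero_eta, Fin.mk_one, Fin.reduceFinMk, Matrix.of_apply, Matrix.cons_val,
      mul_zero, zero_mul, add_zero, zero_add]
  all_goals first
    | exact hasDerivAt_const _ _
    | exact h1.congr_deriv (by ring)
    | exact h2.congr_deriv (by ring)

/-- Conjugation by Q₀ removes the half powers of eᵘ, so the gauge identity becomes rational in w. -/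
theorem frameY_mul_Q0 {a b l : ℂ} (ha : a ≠ 0) (hl : l ≠ 0) (y : ℝ) :
    frameY a b l y * Q0 a b y = Q0 a b y * gaugeB a (conj a) b (conj b) l (eu a b y) := by
  have hw := eu_ne_zero a b y
  have hE := exp_half_mul_self a b y
  have hI := I_mul_I
  ext i j
  simp only [frameY, frameU1, frameV1, Q0, gaugeB, exp_neg_eq, exp_neg_half_eq, Matrix.smul_apply,
    Matrix.add_apply, smul_eq_mul, Matrix.mul_apply, Fin.sum_univ_three, psi,
    map_mul, map_neg, map_pow, conj_I]
  generalize (Real.exp (u a b y / 2) : ℂ) = E at *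
  generalize eu a b y = w at *
  subst hE
  have hE : E ≠ 0 := left_ne_zero_of_mul hw
  fin_cases i <;> fin_cases j <;>
    simp only [Fin.zero_eta, Fin.mk_one, Fin.reduceFinMk, Matrix.of_apply, Matrix.cons_val,
      mul_zero, zero_mul, add_zero, zero_add]
  all_goals try (field_simp <;> ring_nf <;> simp only [I_sq] <;> ring)

theorem det_Q0 {a : ℂ} (ha : a ≠ 0) (b : ℂ) (y : ℝ) : (Q0 a b y).det = 1 := by
  have hE : (Real.exp (u a b y / 2) : ℂ) ≠ 0 := ofReal_ne_zero.2 (Real.exp_pos _).ne'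
  have hI := I_mul_I
  rw [Q0, det_fin_three, exp_neg_half_eq]
  simp only [Matrix.of_apply, Matrix.cons_val]
  field_simp
  linear_combination -(Real.exp (u a b y / 2) : ℂ) * a * hI

/-- The first factor is č at y = 0. The determinant č(0) č(y)² explains the exponents 1/3 and 2/3 in
κ, which make det Q = 1. -/
theorem det_gaugePoly {a A b B l w v : ℂ} (ha : a ≠ 0) (hA : A ≠ 0) (hl : l ≠ 0) (hw : w ≠ 0) :
    (gaugePoly a A b B l w v).det =
      (l ^ 3 * (I * A ^ 2 * B) - (l ^ 3)⁻¹ * (-I * a ^ 2 * b)) *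
        gaugePoly a A b B l w v 2 2 ^ 2 := by
  rw [det_fin_three]
  simp only [gaugePoly, Matrix.of_apply, Matrix.cons_val]
  field_simp
  ring

end MinLag
end

noncomputable section

attribute [local instance] Matrix.linftyOpNormedRing Matrix.linftyOpNormedAlgebra

namespace MinLag

open Complex ComplexConjugate Matrix Metric LinearODE Set

/-! ### Integrals and constancy on a segment -/

/-- The denominator is nonzero only on the segment, but continuity of f and c on all of ℝ gives a
two-sided derivative at the endpoints too. -/
theorem hasDerivAt_integral_div {f c : ℝ → ℂ} (hf : Continuous f) (hc : Continuous c) {y : ℝ}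
    (h0 : ∀ s ∈ uIcc 0 y, c s ≠ 0) {s : ℝ} (hs : s ∈ uIcc 0 y) :
    HasDerivAt (fun t => ∫ x in (0 : ℝ)..t, f x / c x) (f s / c s) s := by
  refine intervalIntegral.integral_hasDerivAt_right ?_ ?_ ?_
  · exact (ContinuousOn.div hf.continuousOn hc.continuousOn fun x hx =>
      h0 x (uIcc_subset_uIcc_left hs hx)).intervalIntegrable
  · exact (hf.measurable.div hc.measurable).stronglyMeasurable.stronglyMeasurableAtFilter
  · exact hf.continuousAt.div hc.continuousAt (h0 s hs)

theorem eq_of_hasDerivAt_zero_on {f : ℝ → ℂ} {y : ℝ} (h : ∀ s ∈ uIcc 0 y, HasDerivAt f 0 s)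
    {s : ℝ} (hs : s ∈ uIcc 0 y) : f s = f 0 := by
  have := (convex_uIcc (0 : ℝ) y).norm_image_sub_le_of_norm_hasDerivWithin_le (C := 0)
    (fun x hx => (h x hx).hasDerivWithinAt) (fun x _ => by simp) left_mem_uIcc hs
  rw [zero_mul, norm_le_zero_iff] at this
  exact sub_eq_zero.1 this

/-! ### The branch `κ` -/

theorem pow_three_mul_cCheck (a b : ℂ) {l : ℂ} (hl : l ≠ 0) (y : ℝ) : l ^ 3 * cCheck a b y l =
    l ^ 6 * conj (psi a b) - psi a b - l ^ 3 * eu a b y * du a b y := by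
  rw [cCheck]
  field_simp

theorem du_zero {a b : ℂ} (ha : a ≠ 0) (hb : b ≠ 0) : du a b 0 = 0 := by
  rw [du, deriv_u_zero ha hb, ofReal_zero]

theorem pow_three_mul_cCheck_zero {a b l : ℂ} (ha : a ≠ 0) (hb : b ≠ 0) (hl : l ≠ 0) :
    l ^ 3 * cCheck a b 0 l = l ^ 6 * conj (psi a b) - psi a b := by
  rw [pow_three_mul_cCheck a b hl, du_zero ha hb, mul_zero, sub_zero]

/-- `(2/3) ∫₀^y č'/č`, the logarithm of `κ(y) / κ(0)`. -/
def logKappa (a b l : ℂ) (y : ℝ) : ℂ :=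
  ∫ s in (0 : ℝ)..y, (2 / 3 * gaugeDeriv a b l s 2 2) / cCheck a b s l

/-- The branch `κ`. -/
def kappa (a b l : ℂ) (y : ℝ) : ℂ :=
  (l ^ 6 * conj (psi a b) - psi a b) * exp (logKappa a b l y)

section

variable {a b l : ℂ} {y : ℝ}

theorem hasDerivAt_logKappa (ha : a ≠ 0) (hb : b ≠ 0) (h0 : ∀ s ∈ uIcc 0 y, cCheck a b s l ≠ 0)
    {s : ℝ} (hs : s ∈ uIcc 0 y) : HasDerivAt (logKappa a b l)
      ((2 / 3 * gaugeDeriv a b l s 2 2) / cCheck a b s l) s :=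
  hasDerivAt_integral_div (continuous_const.mul (continuous_gaugeDeriv ha hb l))
    (continuous_cCheck ha hb l) h0 hs

theorem logKappa_zero (a b l : ℂ) : logKappa a b l 0 = 0 := intervalIntegral.integral_same

theorem kappa_zero (a b l : ℂ) : kappa a b l 0 = l ^ 6 * conj (psi a b) - psi a b := by
  rw [kappa, logKappa_zero, Complex.exp_zero, mul_one]

theorem hasDerivAt_kappa (ha : a ≠ 0) (hb : b ≠ 0) (h0 : ∀ s ∈ uIcc 0 y, cCheck a b s l ≠ 0)
    {s : ℝ} (hs : s ∈ uIcc 0 y) : HasDerivAt (kappa a b l)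
      (kappa a b l s * ((2 / 3 * gaugeDeriv a b l s 2 2) / cCheck a b s l)) s :=
  ((hasDerivAt_logKappa ha hb h0 hs).cexp.const_mul _).congr_deriv (by rw [kappa]; ring)

theorem kappa_ne_zero (ha : a ≠ 0) (hb : b ≠ 0) (hl : l ≠ 0) (h0 : cCheck a b 0 l ≠ 0) (s : ℝ) :
    kappa a b l s ≠ 0 := by
  rw [kappa, ← pow_three_mul_cCheck_zero ha hb hl]
  exact mul_ne_zero (mul_ne_zero (pow_ne_zero 3 hl) h0) (exp_ne_zero _)

/-- The logarithmic derivative of č² is 2č'/č, three times the integrand of `logKappa`. -/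
theorem cCheck_sq (ha : a ≠ 0) (hb : b ≠ 0) (h0 : ∀ s ∈ uIcc 0 y, cCheck a b s l ≠ 0)
    {s : ℝ} (hs : s ∈ uIcc 0 y) :
    cCheck a b s l ^ 2 = cCheck a b 0 l ^ 2 * exp (logKappa a b l s) ^ 3 := by
  have h := eq_of_hasDerivAt_zero_on
    (f := fun s => cCheck a b s l ^ 2 * exp (-logKappa a b l s) ^ 3) (y := y) (fun x hx =>
      (((hasDerivAt_cCheck ha hb l x).fun_pow 2).mul
        ((hasDerivAt_logKappa ha hb h0 hx).neg.cexp.fun_pow 3)).congr_deriv (by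
          have := h0 x hx
          push_cast
          field_simp
          ring)) hs
  simp only [logKappa_zero, neg_zero, Complex.exp_zero, one_pow, mul_one] at h
  rw [← h, mul_assoc, ← mul_pow, ← Complex.exp_add, neg_add_cancel, Complex.exp_zero, one_pow,
    mul_one]

theorem isKappa_kappa (ha : a ≠ 0) (hb : b ≠ 0) (hl : l ≠ 0)
    (h0 : ∀ s ∈ uIcc 0 y, cCheck a b s l ≠ 0) : IsKappa a b l y (kappa a b l) where
  continuousOn s hs := (hasDerivAt_kappa ha hb h0 hs).continuousAt.continuousWithinAt
  cube s hs := by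
    rw [← pow_three_mul_cCheck a b hl, mul_pow _ _ 2, cCheck_sq ha hb h0 hs, kappa,
      ← pow_three_mul_cCheck_zero ha hb hl]
    ring
  zero := kappa_zero a b l

/-- The quotient of two branches is continuous on the segment with values in the finite set of cube
roots of unity; it is therefore constant, and equals 1 at 0. -/
theorem IsKappa.eq_kappa (ha : a ≠ 0) (hb : b ≠ 0) (hl : l ≠ 0)
    (h0 : ∀ s ∈ uIcc 0 y, cCheck a b s l ≠ 0) {κ : ℝ → ℂ} (h : IsKappa a b l y κ) :
    κ y = kappa a b l y := by
  have hk := isKappa_kappa ha hb hl h0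
  have hne := kappa_ne_zero ha hb hl (h0 0 left_mem_uIcc)
  have hT : {z : ℂ | z ^ 3 = 1}.Finite := by
    refine (Polynomial.nthRoots 3 (1 : ℂ)).toFinset.finite_toSet.subset fun z hz => ?_
    simpa using hz
  have hc : ContinuousOn (fun s => κ s / kappa a b l s) (uIcc 0 y) :=
    h.continuousOn.div hk.continuousOn fun s _ => hne s
  have key := isPreconnected_uIcc.constant_of_mapsTo hT.isDiscrete hc (fun s hs => by
    change (κ s / kappa a b l s) ^ 3 = 1
    rw [div_pow, h.cube s hs, ← hk.cube s hs, div_self (pow_ne_zero 3 (hne s))])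
    (left_mem_uIcc (a := (0 : ℝ)) (b := y)) right_mem_uIcc
  simp only [h.zero, hk.zero] at key
  rw [← kappa_zero a b l, div_self (hne 0)] at key
  exact ((div_eq_one_iff_eq (hne y)).1 key.symm)

/-! ### The explicit formula -/

theorem Q_eq (a b l k : ℂ) (y : ℝ) : Q a b y l k = (l ^ 3 / k) •
    (Q0 a b y * gaugePoly a (conj a) b (conj b) l (eu a b y) (du a b y)) := by
  rw [Q, Qtilde, gaugePoly_eq, Matrix.mul_smul]

theorem IsKappa.det_Q (ha : a ≠ 0) (hb : b ≠ 0) (hl : l ≠ 0)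
    (h0 : ∀ s ∈ uIcc 0 y, cCheck a b s l ≠ 0) {κ : ℝ → ℂ} (h : IsKappa a b l y κ) :
    (Q a b y l (κ y)).det = 1 := by
  have hne := kappa_ne_zero ha hb hl (h0 0 left_mem_uIcc) y
  rw [← h.eq_kappa ha hb hl h0] at hne
  have hA : conj a ≠ 0 := by simpa using ha
  have h3 := h.cube y right_mem_uIcc
  have hψ : l ^ 3 * (I * conj a ^ 2 * conj b) - (l ^ 3)⁻¹ * (-I * a ^ 2 * b) =
      cCheck a b 0 l := by
    rw [cCheck, du_zero ha hb, mul_zero, sub_zero]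
    simp [psi]
  rw [← pow_three_mul_cCheck a b hl, ← pow_three_mul_cCheck_zero ha hb hl] at h3
  rw [Q_eq, det_smul, det_mul, det_Q0 ha, det_gaugePoly ha hA hl (eu_ne_zero a b y),
    gaugePoly_two_two, hψ, Fintype.card_fin, div_pow, h3]
  have := h0 0 left_mem_uIcc
  have := h0 y right_mem_uIcc
  field_simp

/-- `Q⁻¹ Q' + Q⁻¹ (i (U - V)) Q`. -/
def gaugeN (a b l : ℂ) (y : ℝ) : Mat3 :=
  (I - (2 * I * l ^ 3 * conj (psi a b) - I * du a b y * eu a b y) / cCheck a b y l) •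
    potential a b l - (2 * eu a b y / cCheck a b y l) • L0 a b l

theorem gaugePoly_mul_gaugeN (ha : a ≠ 0) (hb : b ≠ 0) (hl : l ≠ 0) (h0 : cCheck a b y l ≠ 0) :
    gaugePoly a (conj a) b (conj b) l (eu a b y) (du a b y) * gaugeN a b l y =
      !![du a b y / 2, 0, 0; 0, -du a b y / 2, 0; 0, 0, 0] *
        gaugePoly a (conj a) b (conj b) l (eu a b y) (du a b y)
      + gaugeDeriv a b l y
      + gaugeB a (conj a) b (conj b) l (eu a b y) *
        gaugePoly a (conj a) b (conj b) l (eu a b y) (du a b y)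
      - ((2 / 3 * gaugeDeriv a b l y 2 2) / cCheck a b y l) •
        gaugePoly a (conj a) b (conj b) l (eu a b y) (du a b y) := by
  have hA : conj a ≠ 0 := by simpa using ha
  have key := gaugePoly_identity ha hA hl (eu_ne_zero a b y) rfl (du_sq ha hb y)
  rw [← L0_eq a b l hl] at key
  change _ = _ * ((_ : ℂ) • potential a b l - _) at key
  rw [gaugePoly_two_two] at key
  have hN : gaugeN a b l y = (cCheck a b y l)⁻¹ • ((I * cCheck a b y l -
      (2 * I * l ^ 3 * (I * conj a ^ 2 * conj b) - I * du a b y * eu a b y)) • potential a b l -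
      (2 * eu a b y) • L0 a b l) := by
    have hψ : conj (psi a b) = I * conj a ^ 2 * conj b := by simp [psi]
    rw [gaugeN, hψ, smul_sub, smul_smul, smul_smul]
    congr 2 <;> field_simp
  rw [hN, Matrix.mul_smul, ← key, smul_sub, smul_smul, smul_smul, inv_mul_cancel₀ h0, one_smul,
    gaugeDeriv]
  congr 2
  ring

theorem hasDerivAt_Q (ha : a ≠ 0) (hb : b ≠ 0) (hl : l ≠ 0)
    (h0 : ∀ s ∈ uIcc 0 y, cCheck a b s l ≠ 0) {s : ℝ} (hs : s ∈ uIcc 0 y) :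
    HasDerivAt (fun s => Q a b s l (kappa a b l s))
      (Q a b s l (kappa a b l s) * gaugeN a b l s - frameY a b l s * Q a b s l (kappa a b l s))
      s := by
  have hne := kappa_ne_zero ha hb hl (h0 0 left_mem_uIcc) s
  have h1 : HasDerivAt (fun s => l ^ 3 / kappa a b l s) (-(l ^ 3 / kappa a b l s) *
      ((2 / 3 * gaugeDeriv a b l s 2 2) / cCheck a b s l)) s :=
    (((hasDerivAt_kappa ha hb h0 hs).inv hne).const_mul (l ^ 3)).congr_deriv (by
      generalize (2 / 3 * gaugeDeriv a b l s 2 2) / cCheck a b s l = x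
      field_simp)
  simp only [Q_eq]
  refine hasDerivAt_of_eq (hasDerivAt_smul h1
    (hasDerivAt_mul (hasDerivAt_Q0 ha hb s) (hasDerivAt_gaugePoly ha hb l s))) ?_
  rw [Matrix.smul_mul, mul_assoc (Q0 a b s) _ (gaugeN a b l s),
    gaugePoly_mul_gaugeN ha hb hl (h0 s hs), Matrix.mul_smul, ← mul_assoc (frameY a b l s),
    frameY_mul_Q0 ha hl]
  simp only [mul_add, mul_sub, Matrix.mul_smul, mul_assoc]
  module

/-- At y = 0 the matrix of p̌, q̌, …, č is č times the identity, and κ = λ³č. -/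
theorem Q_zero (ha : a ≠ 0) (hb : b ≠ 0) (hl : l ≠ 0) (h0 : cCheck a b 0 l ≠ 0) :
    Q a b 0 l (kappa a b l 0) = Q0 a b 0 := by
  have hA : conj a ≠ 0 := by simpa using ha
  have heu : eu a b 0 = a * conj a := by
    rw [eu, exp_u_zero ha hb, ← aSq_eq, aSq]
  have hg : gaugePoly a (conj a) b (conj b) l (eu a b 0) (du a b 0) =
      cCheck a b 0 l • (1 : Mat3) := by
    rw [cCheck, heu, du_zero ha hb]
    ext i j
    fin_cases i <;> fin_cases j <;> simp [gaugePoly, psi] <;> field_simp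
  rw [Q_eq, hg, kappa_zero, ← pow_three_mul_cCheck_zero ha hb hl, Matrix.mul_smul, mul_one,
    smul_smul, div_mul_eq_mul_div, div_self (mul_ne_zero (pow_ne_zero 3 hl) h0), one_smul]

theorem commute_potential_L0 (a b l : ℂ) : Commute (potential a b l) (L0 a b l) :=
  ((Commute.refl _).pow_right 2).sub_right ((Commute.one_right _).smul_right _)

/-- By `hasDerivAt_Q`, (SQ)' = SQ((i - β₁')D - β₂'L₀). Because D and L₀ commute, the exponentials of
the opposite integrals cancel this derivative, and the product keeps its value 1 at y = 0. -/
theorem frameSol_mul_Q (ha : a ≠ 0) (hb : b ≠ 0) (hl : l ≠ 0)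
    (h0 : ∀ s ∈ uIcc 0 y, cCheck a b s l ≠ 0) :
    frameSol a b l y * Q a b y l (kappa a b l y) *
      (NormedSpace.exp ((beta1 a b y l - y * I) • potential a b l) *
        NormedSpace.exp (beta2 a b y l • L0 a b l)) = 1 := by
  have hcont1 : Continuous fun s =>
      2 * I * l ^ 3 * conj (psi a b) - I * du a b s * eu a b s := by
    have := continuous_eu ha hb
    have := continuous_du ha hb
    fun_prop
  have hcont2 : Continuous fun s => 2 * eu a b s := continuous_const.mul (continuous_eu ha hb)
  have hc := continuous_cCheck ha hb l
  have key : ∀ s ∈ uIcc 0 y, HasDerivAt (fun s => frameSol a b l s * Q a b s l (kappa a b l s) *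
      (NormedSpace.exp ((beta1 a b s l - s * I) • potential a b l) *
        NormedSpace.exp (beta2 a b s l • L0 a b l))) 0 s := by
    intro s hs
    have hp := (hasDerivAt_integral_div hcont1 hc h0 hs).sub
      ((ofRealCLM.hasDerivAt (x := s)).mul_const I)
    have hq := hasDerivAt_integral_div hcont2 hc h0 hs
    have e1 := hasDerivAt_exp_smul hp (potential a b l)
    have e2 := hasDerivAt_exp_smul hq (L0 a b l)
    refine hasDerivAt_of_eq (hasDerivAt_mul (hasDerivAt_mul (isSol_frameSol ha hb l s)
      (hasDerivAt_Q ha hb hl h0 hs)) (hasDerivAt_mul e1 e2)) ?_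
    have hcomm : NormedSpace.exp ((beta1 a b s l - s * I) • potential a b l) * L0 a b l =
        L0 a b l * NormedSpace.exp ((beta1 a b s l - s * I) • potential a b l) :=
      ((commute_potential_L0 a b l).smul_left _).exp_left
    rw [ofRealCLM_apply, ofReal_one, one_mul, gaugeN]
    change _ + _ * (((_ : ℂ) • (_ * NormedSpace.exp ((beta1 a b s l - s * I) • potential a b l))) *
      NormedSpace.exp (beta2 a b s l • L0 a b l) +
      NormedSpace.exp ((beta1 a b s l - s * I) • potential a b l) *
        ((_ : ℂ) • (_ * NormedSpace.exp (beta2 a b s l • L0 a b l)))) = 0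
    generalize NormedSpace.exp ((beta1 a b s l - s * I) • potential a b l) = E₁ at *
    rw [Matrix.mul_smul E₁, ← mul_assoc E₁, hcomm]
    simp only [mul_sub, sub_mul, mul_add, add_mul, Matrix.mul_smul, Matrix.smul_mul, mul_assoc]
    module
  have hmat := fun i j => eq_of_hasDerivAt_zero_on (fun s hs =>
    hasDerivAt_matrix_iff.1 (key s hs) i j) (right_mem_uIcc (a := (0 : ℝ)) (b := y))
  have h := Matrix.ext hmat
  rw [h, beta1, beta2, intervalIntegral.integral_same, intervalIntegral.integral_same,
    ofReal_zero, zero_mul, sub_zero, exp_zero_smul, exp_zero_smul, one_mul, mul_one,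
    Q_zero ha hb hl (h0 0 left_mem_uIcc), frameSol_zero, Q0Inv_mul_Q0 ha hb]

theorem extFrame_eq (ha : a ≠ 0) (hb : b ≠ 0) (hl : l ≠ 0) {z : ℂ}
    (h0 : ∀ s ∈ uIcc 0 z.im, cCheck a b s l ≠ 0) {κ : ℝ → ℂ} (h : IsKappa a b l z.im κ) :
    extFrame a b z l = NormedSpace.exp (z • potential a b l
      - beta1 a b z.im l • potential a b l - beta2 a b z.im l • L0 a b l) *
        (Q a b z.im l (κ z.im))⁻¹ := by
  have hdet : IsUnit (Q a b z.im l (κ z.im)).det := by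
    rw [h.det_Q ha hb hl h0]
    exact isUnit_one
  have key := frameSol_mul_Q ha hb hl h0
  rw [← h.eq_kappa ha hb hl h0] at key
  set β₁ := beta1 a b z.im l
  set β₂ := beta2 a b z.im l
  have e1 : NormedSpace.exp (z • potential a b l - β₁ • potential a b l - β₂ • L0 a b l) =
      NormedSpace.exp ((z.re : ℂ) • potential a b l) *
        (NormedSpace.exp ((z.im * I - β₁) • potential a b l) *
          NormedSpace.exp (-β₂ • L0 a b l)) := by
    rw [← mul_assoc, ← exp_add_smul, ← Matrix.exp_add_of_commute _ _
      (((commute_potential_L0 a b l).smul_left _).smul_right _)]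
    congr 1
    conv_lhs => rw [← re_add_im z]
    module
  have e2 : NormedSpace.exp ((β₁ - z.im * I) • potential a b l) *
      NormedSpace.exp ((z.im * I - β₁) • potential a b l) = 1 := by
    rw [← exp_add_smul, sub_add_sub_cancel, sub_self, exp_zero_smul]
  have e3 : NormedSpace.exp (β₂ • L0 a b l) * NormedSpace.exp (-β₂ • L0 a b l) = 1 := by
    rw [← exp_add_smul, add_neg_cancel, exp_zero_smul]
  have e4 : NormedSpace.exp (β₂ • L0 a b l) *
      NormedSpace.exp ((z.im * I - β₁) • potential a b l) =
      NormedSpace.exp ((z.im * I - β₁) • potential a b l) * NormedSpace.exp (β₂ • L0 a b l) :=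
    ((((commute_potential_L0 a b l).symm.smul_left _).smul_right _).exp_left).exp_right
  have e5 : frameSol a b l z.im * Q a b z.im l (κ z.im) =
      NormedSpace.exp ((z.im * I - β₁) • potential a b l) * NormedSpace.exp (-β₂ • L0 a b l) := by
    calc _ = frameSol a b l z.im * Q a b z.im l (κ z.im) *
          (NormedSpace.exp ((β₁ - z.im * I) • potential a b l) *
            (NormedSpace.exp (β₂ • L0 a b l) *
              NormedSpace.exp ((z.im * I - β₁) • potential a b l)) *
            NormedSpace.exp (-β₂ • L0 a b l)) := by
          rw [e4, ← mul_assoc (NormedSpace.exp _), e2, one_mul, e3, mul_one]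
      _ = _ := by
          rw [← one_mul (NormedSpace.exp ((z.im * I - β₁) • potential a b l) * _), ← key]
          simp only [mul_assoc]
  rw [e1, ← e5, extFrame, mul_assoc, mul_nonsing_inv_cancel_right _ _ hdet]

theorem Q0_zero_eq_one (ha : a ≠ 0) (hb : b ≠ 0) (h : a = I * ‖a‖) : Q0 a b 0 = 1 := by
  have hn : (‖a‖ : ℂ) ≠ 0 := by simpa using ha
  have h1 : I * a⁻¹ * ‖a‖ = 1 := by
    rw [mul_right_comm, ← h, mul_inv_cancel₀ ha]
  have h2 : -I * a * (‖a‖ : ℂ)⁻¹ = 1 := by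
    rw [mul_inv_eq_iff_eq_mul₀ hn, one_mul]
    nth_rw 1 [h]
    linear_combination -(‖a‖ : ℂ) * I_mul_I
  rw [Q0_zero ha hb, h1, h2, ← Matrix.one_fin_three]

end

end MinLag
end

theorem mainTheorem2 (a b : ℂ) (ha : a ≠ 0) (hb : b ≠ 0) :
    -- `u` is well defined and differentiable
    (∀ y, 0 < MinLag.conformalFactor a b y) ∧ Differentiable ℝ (MinLag.u a b) ∧
    -- the formula makes sense for all `y` if `|λ| = 1`, `λ⁶ψ̄ ≠ ψ`, and for all small `λ ≠ 0`
    (∀ l : ℂ, ‖l‖ = 1 → l ^ 6 * (starRingEnd ℂ) (MinLag.psi a b) ≠ MinLag.psi a b →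
      ∀ y, MinLag.cCheck a b y l ≠ 0) ∧
    (∃ ε > 0, ∀ l : ℂ, l ≠ 0 → ‖l‖ < ε → ∀ y, MinLag.cCheck a b y l ≠ 0) ∧
    ∃ F : ℂ → ℂ → Mat3,
      -- `F` is an extended frame, with the metric and the cubic form given by `u` and `ψ`
      MinLag.IsExtendedFrame (fun z => MinLag.u a b z.im) (MinLag.psi a b) F ∧
      (∀ (t : ℝ) (z l : ℂ), l ≠ 0 →
        F (t + z) l = NormedSpace.exp ((t : ℂ) • MinLag.potential a b l) * F z l) ∧
      -- normalized at `z = 0`, it is the unique one generated by `D(λ) dz`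
      (∀ l : ℂ, l ≠ 0 → F 0 l * MinLag.Q0 a b 0 = 1) ∧
      (a = Complex.I * ‖a‖ → MinLag.Q0 a b 0 = 1) ∧
      MinLag.IsGeneratedBy (MinLag.potential a b) (fun z l => F z l * MinLag.Q0 a b 0) ∧
      (∀ F' : ℂ → ℂ → Mat3, MinLag.IsGeneratedBy (MinLag.potential a b) F' →
        ∀ z l : ℂ, ‖l‖ = 1 → F' z l = F z l * MinLag.Q0 a b 0) ∧
      -- the explicit formula
      (∀ z l : ℂ, l ≠ 0 → (∀ s ∈ Set.uIcc 0 z.im, MinLag.cCheck a b s l ≠ 0) →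
        (∃ κ, MinLag.IsKappa a b l z.im κ) ∧
        ∀ κ, MinLag.IsKappa a b l z.im κ →
          (MinLag.Q a b z.im l (κ z.im)).det = 1 ∧
          F z l =
            NormedSpace.exp (z • MinLag.potential a b l
              - MinLag.beta1 a b z.im l • MinLag.potential a b l
              - MinLag.beta2 a b z.im l • MinLag.L0 a b l)
            * (MinLag.Q a b z.im l (κ z.im))⁻¹) := by 
  refine ⟨fun y => MinLag.conformalFactor_pos ha hb y, MinLag.differentiable_u ha hb,
    fun l hl h y => MinLag.cCheck_ne_zero_of_norm_eq_one ha hb hl h y,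
    MinLag.exists_cCheck_ne_zero ha hb, MinLag.extFrame a b,
    MinLag.isExtendedFrame_extFrame ha hb, fun t z l _ => MinLag.extFrame_add a b t z l,
    fun l _ => MinLag.extFrame_zero_mul_Q0 ha hb l, MinLag.Q0_zero_eq_one ha hb,
    MinLag.isGeneratedBy_extFrame ha hb,
    fun F' hF z l hl => MinLag.eq_extFrame_of_isGeneratedBy ha hb hF z hl, fun z l hl h0 =>
    ⟨⟨_, MinLag.isKappa_kappa ha hb hl h0⟩, fun κ hκ =>
      ⟨hκ.det_Q ha hb hl h0, MinLag.extFrame_eq ha hb hl h0 hκ⟩⟩⟩
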